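/- Let $q$ be a prime power, let $0\le h<k$ be integers and $n=4k+h$. For $i=1,2,3$ let $\mathbf P_i$ be the companion matrix (ones above the diagonal, last row $(-a_0,\dots,-a_{m-1})$) of a primitive polynomial $x^m+a_{m-1}x^{m-1}+\dots+a_0$ of degree $m=ik+h$ over $\mathbb F_q$, and let $G_i=\{\mathrm{diag}(\mathbf I_{(3-i)k},\mathbf I_k,\mathbf X):\mathbf X\in\langle \mathbf P_i\rangle\}\le \mathrm{GL}_n(\mathbb F_q)$. For a matrix $\mathbf W$ let $\mathbf W^{(j)}$ be the matrix of its first $j$ rows, $\mathbf W^{[j]}$ the matrix of its remaining rows, and $\mathrm{rs}(\mathbf W)$ its row space. Define the $(n-1)\times n$ matrices $$\mathbf A_i=\begin{bmatrix}\mathbf 0&\mathbf I_k&\mathbf I_{ik+h}^{(k)}\\ \mathbf 0&\mathbf 0&\mathbf I_{ik+h}^{[k]}\\ \mathbf I_{(3-i)k}&\mathbf 0&\mathbf 0\\ \mathbf 0&\mathbf 0&\mathbf I_{ik+h}^{(k-1)}\end{bmatrix},\qquad \mathbf B_i=\begin{bmatrix}\mathbf 0&\mathbf I_k&\mathbf 0\\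 \mathbf 0&\mathbf 0&\mathbf I_{ik+h}^{[k]}\\ \mathbf I_{(3-i)k}&\mathbf 0&\mathbf 0\\ \mathbf 0&\mathbf 0&\mathbf I_{ik+h}^{(k-1)}\end{bmatrix},$$ and let $\mathbf M$ be the $(n-1)\times n$ matrix with rows $e_n,e_{n-1},\dots,e_2$ (unit vectors). Let $\mathcal W=\{\mathbf A_ig,\ \mathbf B_i,\ \mathbf M: 1\le i\le 3,\ g\in G_i\}$ and $\mathscr C=\{\mathrm{rs}(\mathbf W):\mathbf W\in\mathcal W\}$. For $\mathbf t=(t_1,\dots,t_r)$ with $r\ge 1$ and $1\le t_1<\dots<t_r\le n-1$ let $$\mathcal C_{\mathbf t}=\{(\mathrm{rs}(\mathbf W^{(t_1)}),\dots,\mathrm{rs}(\mathbf W^{(t_r)})):\mathbf W\in\mathcal W\},\qquad \mathcal C=\mathcal C_{(1,2,\dots,n-1)}.$$ A flag of type $\mathbf t$ is a chain $\{0\}\subsetneq F_1\subsetneq\dots\subsetneq F_r\subsetneq\mathbb F_q^n$ of subspaces with $\dim F_i=t_i$; a flag code of type $\mathbf t$ is a non-empty set of such flags. With $d_S(U,V)=\dim(U+V)-\dim(U\cap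 V)$, the distance of two flags is $\sum_i d_S(F_i,F_i')$, and $d_f(C)$ is the minimum distance of two distinct flags of $C$. The $i$-projected code of $C$ is the set of all $i$-th components of its flags; $C$ is cardinality-consistent if each of its projected codes has $|C|$ elements. (i) If $\{t_1,\dots,t_r\}\subseteq\{1,\dots,k+h\}\cup\{3k+h,\dots,n-1\}$, then $\mathcal C_{\mathbf t}$ is a cardinality-consistent flag code of type $\mathbf t$ with $|\mathcal C_{\mathbf t}|=|\mathcal C|=|\mathscr C|=\sum_{i=1}^3q^{ik+h}+1$ and $$d_f(\mathcal C_{\mathbf t})=\sum_{t_i\le k}2t_i+\sum_{t_i\ge n-k}2(n-t_i)+\sum_{k+1\le t_i\le k+h}2k .$$ (ii) Let $2k+h\in\{t_1,\dots,t_r\}\subseteq\{1,\dots,k+h\}\cup\{2k+h\}\cup\{3k+h,\dots,n-1\}$. If $h\ge 1$, then $\mathcal C_{\mathbf t}$ is a cardinality-consistent flag code of type $\mathbf t$ with $|\mathcal C_{\mathbf t}|=|\mathcal C|=|\mathscr C|=\sum_{i=1}^3q^{ik+h}+1$ and $$d_f(\mathcal C_{\mathbf t})=\sum_{t_i\le k}2t_i+\sum_{t_i\ge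 n-k}2(n-t_i)+\Bigl(\sum_{k+1\le t_i\le k+h}2k\Bigr)+2h .$$ If $h=0$ and $r\ge2$, then $\mathcal C_{\mathbf t}$ is a flag code of type $\mathbf t$ with the same sizes and the same formula for $d_f(\mathcal C_{\mathbf t})$, and its $i$-projected code has $|\mathcal C_{\mathbf t}|$ elements for every $i$ with $t_i\ne 2k$. -/

import Mathlib

open scoped Polynomial

noncomputable section

namespace FlagCodes

/-! ### Subspaces, flags and flag codes of `F ^ n` -/

/-- The subspace distance `dim (U + V) - dim (U ∩ V)`. -/
def subspaceDist {F : Type*} [Field F] {n : ℕ} (U V : Submodule F (Fin n → F)) : ℕ :=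
  Module.finrank F ↥(U ⊔ V) - Module.finrank F ↥(U ⊓ V)

/-- The set of all flags of type `t = (t 0, …, t (r - 1))` on `F ^ n`: strictly increasing sequences
of subspaces, all different from `0` and from `F ^ n`, with the prescribed dimensions. -/
def flags (F : Type*) [Field F] (n : ℕ) {r : ℕ} (t : Fin r → ℕ) :
    Set (Fin r → Submodule F (Fin n → F)) :=
  {𝓕 | StrictMono 𝓕 ∧ (∀ i, ⊥ < 𝓕 i) ∧ (∀ i, 𝓕 i < ⊤) ∧ ∀ i, Module.finrank F ↥(𝓕 i) = t i}

/-- A flag code of type `t`: a non-empty set of flags of type `t`. -/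
def IsFlagCode {F : Type*} [Field F] {n r : ℕ} (t : Fin r → ℕ)
    (C : Set (Fin r → Submodule F (Fin n → F))) : Prop :=
  C.Nonempty ∧ C ⊆ flags F n t

/-- The flag distance: the sum of the subspace distances of the components. -/
def flagDist {F : Type*} [Field F] {n r : ℕ} (𝓕 𝓖 : Fin r → Submodule F (Fin n → F)) : ℕ :=
  ∑ i, subspaceDist (𝓕 i) (𝓖 i)

/-- `d` is the minimum of the flag distances of pairs of distinct elements of `C`
(in particular such pairs exist and the minimum is attained). -/
def IsMinFlagDist {F : Type*} [Field F] {n r : ℕ}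
    (C : Set (Fin r → Submodule F (Fin n → F))) (d : ℕ) : Prop :=
  IsLeast {e | ∃ 𝓕 ∈ C, ∃ 𝓖 ∈ C, 𝓕 ≠ 𝓖 ∧ e = flagDist 𝓕 𝓖} d

/-- The `i`-projected code: all `i`-th components of elements of `C`. -/
def projectedCode {F : Type*} [Field F] {n r : ℕ}
    (C : Set (Fin r → Submodule F (Fin n → F))) (i : Fin r) : Set (Submodule F (Fin n → F)) :=
  (fun 𝓕 => 𝓕 i) '' C

/-- All projected codes have as many elements as the code itself. -/
def CardinalityConsistent {F : Type*} [Field F] {n r : ℕ}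
    (C : Set (Fin r → Submodule F (Fin n → F))) : Prop :=
  ∀ i, (projectedCode C i).ncard = C.ncard

/-- The row space of a matrix. -/
def rowSpace {F : Type*} [Field F] {m n : ℕ} (W : Matrix (Fin m) (Fin n) F) :
    Submodule F (Fin n → F) :=
  Submodule.span F (Set.range W.row)

/-- The span of the first `j` rows of a matrix. -/
def initialRowSpace {F : Type*} [Field F] {m n : ℕ} (W : Matrix (Fin m) (Fin n) F) (j : ℕ) :
    Submodule F (Fin n → F) :=
  Submodule.span F (W.row '' {x | (x : ℕ) < j})

/-! ### Primitive polynomials and companion matrices -/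

/-- `f` is a primitive polynomial (in the sense of finite fields) of degree `m` over the finite
field `F`: it is monic and irreducible of degree `m`, and its root in the field `F[X] / (f)` with
`|F| ^ m` elements generates the multiplicative group of that field. -/
def IsPrimitivePoly {F : Type*} [Field F] [Fintype F] (f : F[X]) (m : ℕ) : Prop :=
  f.Monic ∧ Irreducible f ∧ f.natDegree = m ∧
    orderOf (AdjoinRoot.root f) = Fintype.card F ^ m - 1

/-- The companion matrix of a monic polynomial `f` of degree `m`: ones above the diagonal and last
row `(-a₀, …, -aₘ₋₁)`, where the `aⱼ` are the coefficients of `f`. -/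
def companionMatrix {F : Type*} [Field F] (m : ℕ) (f : F[X]) : Matrix (Fin m) (Fin m) F :=
  Matrix.of fun x y =>
    if (x : ℕ) + 1 = m then -f.coeff y else if (y : ℕ) = x + 1 then 1 else 0

/-! ### The construction on `F ^ n`, `n = s * k + h`

Rows and columns are numbered from `0`. For `1 ≤ i ≤ s - 1` the columns fall into three blocks, of
widths `(s - i - 1) * k`, `k` and `i * k + h`, which start at the columns `0`, `(s - i - 1) * k`
and `(s - i) * k`. The rows of `matA` and `matB` fall into four blocks, of heights `k`,
`i * k + h - k`, `(s - i - 1) * k` and `k - 1`, which start at the rows `0`, `k`, `i * k + h` and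
`(s - 1) * k + h`. -/

/-- The block diagonal `n × n` matrix with an identity block of size `a` followed by `X`
(it is used with `a + m = n`). -/
def blockDiag {F : Type*} [Field F] (n a : ℕ) {m : ℕ} (X : Matrix (Fin m) (Fin m) F) :
    Matrix (Fin n) (Fin n) F :=
  Matrix.of fun x y =>
    if hxy : (a ≤ x ∧ (x : ℕ) - a < m) ∧ (a ≤ y ∧ (y : ℕ) - a < m) then
      X ⟨x - a, hxy.1.2⟩ ⟨y - a, hxy.2.2⟩
    else if x = y then 1 else 0

/-- The cyclic group `G_i`, as a set of matrices: all block diagonal matrices with an identity block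
of size `(s - i - 1) * k + k = (s - i) * k` and a power of the companion matrix `P` of `f`, of size
`i * k + h`. (For primitive `f` the matrix `P` has finite order, so its powers with exponents in `ℕ`
are the group that it generates.) -/
def groupG {F : Type*} [Field F] (s k h : ℕ) (f : F[X]) (i : ℕ) :
    Set (Matrix (Fin (s * k + h)) (Fin (s * k + h)) F) :=
  {g | ∃ j : ℕ, g = blockDiag (s * k + h) ((s - i) * k) (companionMatrix (i * k + h) f ^ j)}

/-- The matrix `A_i`, with `I` the identity matrix of size `i * k + h` and `I'` that of size
`(s - i - 1) * k`; its four blocks of rows are `(0, 1, first k rows of I)`, `(0, 0, other rows of I)`,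
`(I', 0, 0)` and `(0, 0, first k - 1 rows of I)`. -/
def matA (F : Type*) [Field F] (s k h i : ℕ) :
    Matrix (Fin (s * k + h - 1)) (Fin (s * k + h)) F :=
  Matrix.of fun x y =>
    if (x : ℕ) < k then
      if (y : ℕ) = (s - i - 1) * k + x ∨ (y : ℕ) = (s - i) * k + x then 1 else 0
    else if (x : ℕ) < i * k + h then
      if (y : ℕ) = (s - i) * k + x then 1 else 0
    else if (x : ℕ) < (s - 1) * k + h then
      if (y : ℕ) = x - (i * k + h) then 1 else 0
    else
      if (y : ℕ) = (s - i) * k + (x - ((s - 1) * k + h)) then 1 else 0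

/-- The matrix `B_i`: it is `A_i` with the block `first k rows of I` replaced by zero. -/
def matB (F : Type*) [Field F] (s k h i : ℕ) :
    Matrix (Fin (s * k + h - 1)) (Fin (s * k + h)) F :=
  Matrix.of fun x y =>
    if (x : ℕ) < k then
      if (y : ℕ) = (s - i - 1) * k + x then 1 else 0
    else if (x : ℕ) < i * k + h then
      if (y : ℕ) = (s - i) * k + x then 1 else 0
    else if (x : ℕ) < (s - 1) * k + h then
      if (y : ℕ) = x - (i * k + h) then 1 else 0
    else
      if (y : ℕ) = (s - i) * k + (x - ((s - 1) * k + h)) then 1 else 0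

/-- The matrix `M`, whose rows are the last, the second to last, …, the second unit vector. -/
def matM (F : Type*) [Field F] (n : ℕ) : Matrix (Fin (n - 1)) (Fin n) F :=
  Matrix.of fun x y => if (x : ℕ) + y = n - 1 then 1 else 0

/-- The generator matrices `A_i * g`, `B_i`, `M` with `1 ≤ i ≤ s - 1` and `g ∈ G_i`, where `f i` is
the polynomial that defines `G_i`. -/
def generators {F : Type*} [Field F] (s k h : ℕ) (f : ℕ → F[X]) :
    Set (Matrix (Fin (s * k + h - 1)) (Fin (s * k + h)) F) :=
  {W | (∃ i ∈ Finset.Icc 1 (s - 1), ∃ g ∈ groupG s k h (f i) i, W = matA F s k h i * g) ∨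
    (∃ i ∈ Finset.Icc 1 (s - 1), W = matB F s k h i) ∨ W = matM F (s * k + h)}

/-- The subspace code formed by the row spaces of the generator matrices. -/
def subspaceCode {F : Type*} [Field F] (s k h : ℕ) (f : ℕ → F[X]) :
    Set (Submodule F (Fin (s * k + h) → F)) :=
  rowSpace '' generators s k h f

/-- The code `𝒞_t` of all sequences `(W⁽ᵗ⁰⁾, W⁽ᵗ¹⁾, …)`, for `W` a generator matrix and `W⁽ʲ⁾` the
span of its first `j` rows. -/
def flagCode {F : Type*} [Field F] (s k h : ℕ) (f : ℕ → F[X]) {r : ℕ} (t : Fin r → ℕ) :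
    Set (Fin r → Submodule F (Fin (s * k + h) → F)) :=
  {𝓕 | ∃ W ∈ generators s k h f, 𝓕 = fun i => initialRowSpace W (t i)}

/-- The code `𝒞` of full flags, of type `(1, 2, …, n - 1)`. -/
def fullFlagCode {F : Type*} [Field F] (s k h : ℕ) (f : ℕ → F[X]) :
    Set (Fin (s * k + h - 1) → Submodule F (Fin (s * k + h) → F)) :=
  flagCode s k h f fun j => (j : ℕ) + 1

end FlagCodes

end

noncomputable section

namespace FlagCodes

/-! ### Spans of initial segments of a sequence of vectors -/

/-! Put m = ik + h and a = (3 - i)k, so that a + k + m = n, and identify F^m with the field K_i =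
F[X]/(f_i) through the powers of the root α. The companion matrix then acts on row vectors as
multiplication by α, and every generator of index i has the rows described by `genRow`, with β = γ a
power of α for A_i g and (β, γ) = (0, 1) for B_i. Since f_i is primitive, the powers of α exhaust
the nonzero elements. Thus β runs through all of K_i, and the generators are indexed by M and the
disjoint union of K_1, K_2, K_3, which explains the cardinality.

Everything rests on three estimates for two distinct generators, collected in `FarApart`.
Intersections are bounded by exhibiting d linear conditions on the coefficients that force a common
vector to vanish (`finrank_prefixSpan_inf_le`); sums are shown to be the whole space by showing that
a functional vanishing on both summands is zero. For equal indices, β - β' is invertible in K_i, so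
the last blocks separate the generators. For i < i', the middle columns of index i' lie under the
identity block of index i, which the early rows do not reach. Only the pair (1, 3) in dimension 2k +
h needs separate arguments.

The dimension formula turns these estimates into a lower bound for each component of the flag
distance. B_1 and B_3 attain all these bounds at once, since their prefix spans are coordinate
subspaces. A positive bound in a dimension makes the projection to that component injective; the
bound is zero only for h = 0 and dimension 2k, whence the extra hypothesis r ≥ 2 there. -/

/-- The span of the first `t` terms of a sequence of vectors. -/
def prefixSpan (F : Type*) [Field F] {E : Type*} [AddCommGroup E] [Module F E] (w : ℕ → E) (t : ℕ) :
    Submodule F E :=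
  Submodule.span F (w '' (Finset.range t : Set ℕ))

section PrefixSpan

variable {F : Type*} [Field F] {E : Type*} [AddCommGroup E] [Module F E]

theorem mem_prefixSpan_iff {w : ℕ → E} {t : ℕ} {v : E} :
    v ∈ prefixSpan F w t ↔ ∃ c : ℕ → F, ∑ x ∈ Finset.range t, c x • w x = v := by
  rw [prefixSpan, Submodule.mem_span_image_finset_iff_exists_fun]
  constructor
  · rintro ⟨c, hc⟩
    refine ⟨fun x => if hx : x ∈ Finset.range t then c ⟨x, hx⟩ else 0, ?_⟩
    rw [← hc, ← Finset.sum_coe_sort]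
    exact Finset.sum_congr rfl fun x _ => by beta_reduce; rw [dif_pos x.2]
  · rintro ⟨c, hc⟩
    exact ⟨fun x => c x, (Finset.sum_coe_sort (Finset.range t) fun x => c x • w x).trans hc⟩

theorem apply_mem_prefixSpan {w : ℕ → E} {t x : ℕ} (hx : x < t) : w x ∈ prefixSpan F w t :=
  Submodule.subset_span ⟨x, by simpa using hx, rfl⟩

theorem prefixSpan_mono (w : ℕ → E) : Monotone (prefixSpan F w) := fun s t hst =>
  Submodule.span_mono (Set.image_mono (by simpa using hst))

/-- A bound for the dimension of the intersection of two spans: all pairs of coefficient sequences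
that represent the same vector are separated by a linear map into `F ^ d`. -/
theorem finrank_prefixSpan_inf_le {w w' : ℕ → E} {t d : ℕ}
    (L : ((ℕ → F) × (ℕ → F)) →ₗ[F] (Fin d → F))
    (hL : ∀ c c' : ℕ → F,
      ∑ x ∈ Finset.range t, c x • w x = ∑ x ∈ Finset.range t, c' x • w' x →
      L (c, c') = 0 → ∑ x ∈ Finset.range t, c x • w x = 0) :
    Module.finrank F ↥(prefixSpan F w t ⊓ prefixSpan F w' t) ≤ d := by
  let T : (ℕ → E) → (ℕ → F) →ₗ[F] E := fun u =>
    ∑ x ∈ Finset.range t, (LinearMap.proj x : (ℕ → F) →ₗ[F] F).smulRight (u x)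
  have hT : ∀ u c, T u c = ∑ x ∈ Finset.range t, c x • u x := fun u c => by simp [T]
  let S : Submodule F ((ℕ → F) × (ℕ → F)) :=
    LinearMap.ker (T w ∘ₗ LinearMap.fst F _ _ - T w' ∘ₗ LinearMap.snd F _ _)
  have hS : ∀ p : S, T w p.1.1 = T w' p.1.2 := fun p =>
    sub_eq_zero.1 (LinearMap.mem_ker.1 p.2)
  let R : S →ₗ[F] ↥(prefixSpan F w t ⊓ prefixSpan F w' t) :=
    LinearMap.codRestrict _ (T w ∘ₗ LinearMap.fst F _ _ ∘ₗ S.subtype) fun p =>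
      ⟨mem_prefixSpan_iff.2 ⟨p.1.1, (hT _ _).symm⟩,
        mem_prefixSpan_iff.2 ⟨p.1.2, ((hS p).trans (hT _ _)).symm⟩⟩
  have hR : LinearMap.range R = ⊤ := by
    refine LinearMap.range_eq_top.2 ?_
    rintro ⟨v, hv, hv'⟩
    obtain ⟨c, hc⟩ := mem_prefixSpan_iff.1 hv
    obtain ⟨c', hc'⟩ := mem_prefixSpan_iff.1 hv'
    refine ⟨⟨(c, c'), ?_⟩, Subtype.ext ?_⟩
    · simp [S, hT, hc, hc']
    · exact (hT _ _).trans hc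
  -- `S` is infinite-dimensional, so the count goes through a linear section of `R`: followed by
  -- `L`, it is injective on the intersection.
  obtain ⟨s, hs⟩ := R.exists_rightInverse_of_surjective hR
  have hinj : Function.Injective (L ∘ₗ S.subtype ∘ₗ s) := by
    refine (injective_iff_map_eq_zero _).2 fun v hv => ?_
    have h1 : R (s v) = v := LinearMap.congr_fun hs v
    have h2 := hL (s v).1.1 (s v).1.2 (by rw [← hT, ← hT]; exact hS _) hv
    rw [← h1]
    refine Subtype.ext ?_
    rw [← hT] at h2
    exact h2
  simpa using LinearMap.finrank_le_finrank_of_injective hinj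

/-- A proper subspace lies in the kernel of a nonzero functional. -/
theorem eq_top_of_forall_functional {U : Submodule F E}
    (h : ∀ φ : E →ₗ[F] F, (∀ u ∈ U, φ u = 0) → φ = 0) : U = ⊤ := by
  by_contra hU
  obtain ⟨φ, hφ, hφU⟩ := Submodule.exists_le_ker_of_lt_top U (lt_top_iff_ne_top.2 hU)
  exact hφ (h φ fun u hu => hφU hu)

/-- Spanning vectors, as many as the dimension, are independent, hence so are the first t. For this
reason the n - 1 rows of a generator are continued by an n-th vector. -/
theorem finrank_prefixSpan [Module.Finite F E] {w : ℕ → E}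
    (h : prefixSpan F w (Module.finrank F E) = ⊤) {t : ℕ} (ht : t ≤ Module.finrank F E) :
    Module.finrank F ↥(prefixSpan F w t) = t := by
  have key : ∀ s, prefixSpan F w s = Submodule.span F (Set.range fun x : Fin s => w x) := by
    intro s
    unfold prefixSpan
    congr 1
    ext v
    constructor
    · rintro ⟨x, hx, rfl⟩
      exact ⟨⟨x, by simpa using hx⟩, rfl⟩
    · rintro ⟨x, rfl⟩
      exact ⟨x, by simp, rfl⟩
  have hli : LinearIndependent F fun x : Fin (Module.finrank F E) => w x :=
    linearIndependent_of_top_le_span_of_card_eq_finrank (by rw [← key, h]) (by simp)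
  have hli' : LinearIndependent F fun x : Fin t => w x :=
    hli.comp (Fin.castLE ht) (Fin.castLE_injective ht)
  rw [key, finrank_span_eq_card hli', Fintype.card_fin]

end PrefixSpan

/-! ### Unit vectors and coordinates, indexed by natural numbers -/

section Coordinates

variable {F : Type*} [Field F] {n : ℕ}

/-- The unit vector with a one in column `y`; it is zero for `n ≤ y`. -/
def unitVec (F : Type*) [Field F] (n y : ℕ) : Fin n → F := fun z => if (z : ℕ) = y then 1 else 0

/-- The coordinate in column `y`. -/
def coord (F : Type*) [Field F] {n y : ℕ} (hy : y < n) : (Fin n → F) →ₗ[F] F :=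
  LinearMap.proj ⟨y, hy⟩

theorem coord_unitVec {y : ℕ} (hy : y < n) (z : ℕ) :
    coord F hy (unitVec F n z) = if z = y then 1 else 0 := by
  simp [coord, unitVec, eq_comm]

theorem functional_eq_zero {φ : (Fin n → F) →ₗ[F] F} (h : ∀ y < n, φ (unitVec F n y) = 0) :
    φ = 0 := by
  refine LinearMap.pi_ext' fun y => LinearMap.ext_ring ?_
  have : unitVec F n y = Pi.single y 1 := by
    ext z
    simp [unitVec, Pi.single_apply, Fin.ext_iff]
  simpa [this] using h y y.2

theorem linearIndependent_unitVec {d : ℕ} {g : Fin d → ℕ} (hg : Function.Injective g)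
    (hgn : ∀ x, g x < n) : LinearIndependent F fun x => unitVec F n (g x) := by
  have : (fun x => unitVec F n (g x)) = (Pi.basisFun F (Fin n)) ∘ fun x => ⟨g x, hgn x⟩ := by
    ext x z
    simp [unitVec, Pi.single_apply, Fin.ext_iff]
  rw [this]
  exact (Pi.basisFun F (Fin n)).linearIndependent.comp _ fun x y hxy =>
    hg (congrArg Fin.val hxy)

theorem le_finrank_of_unitVec_mem {d : ℕ} {g : Fin d → ℕ} (hg : Function.Injective g)
    (hgn : ∀ x, g x < n) {U : Submodule F (Fin n → F)} (hU : ∀ x, unitVec F n (g x) ∈ U) :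
    d ≤ Module.finrank F U := by
  have h := finrank_span_eq_card (linearIndependent_unitVec (F := F) hg hgn)
  rw [Fintype.card_fin] at h
  rw [← h]
  refine Submodule.finrank_mono (Submodule.span_le.2 ?_)
  rintro _ ⟨x, rfl⟩
  exact hU x

end Coordinates

/-! ### Embedding an extension field as a block of columns -/

section Block

variable {F K : Type*} [Field F] [Field K] [Algebra F K] {m : ℕ} (b : Module.Basis (Fin m) F K)

/-- The linear map that writes the coordinates of a field element into the columns
`o, …, o + m - 1`. -/
def blockEmb (n o : ℕ) : K →ₗ[F] (Fin n → F) :=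
  b.constr F fun x => unitVec F n (o + x)

/-- The field element with coordinates in the columns `o, …, o + m - 1`. -/
def blockProj {n o : ℕ} (ho : o + m ≤ n) : (Fin n → F) →ₗ[F] K :=
  ∑ x : Fin m, (coord F (lt_of_lt_of_le (Nat.add_lt_add_left x.2 o) ho)).smulRight (b x)

variable {b}

theorem blockEmb_basis (n o : ℕ) (x : Fin m) : blockEmb b n o (b x) = unitVec F n (o + x) := by
  simp [blockEmb]

theorem blockProj_unitVec {n o : ℕ} (ho : o + m ≤ n) {y : ℕ} (hy : y < o) :
    blockProj b ho (unitVec F n y) = 0 := by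
  simp only [blockProj, LinearMap.sum_apply, LinearMap.smulRight_apply, coord_unitVec]
  refine Finset.sum_eq_zero fun x _ => ?_
  rw [if_neg (by omega), zero_smul]

theorem blockProj_blockEmb {n o : ℕ} (ho : o + m ≤ n) (γ : K) :
    blockProj b ho (blockEmb b n o γ) = γ := by
  have : blockProj b ho ∘ₗ blockEmb b n o = LinearMap.id := by
    refine b.ext fun x => ?_
    simp only [LinearMap.comp_apply, blockEmb_basis, LinearMap.id_apply, blockProj,
      LinearMap.sum_apply, LinearMap.smulRight_apply, coord_unitVec]
    rw [Finset.sum_eq_single x]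
    · simp
    · intro z _ hz
      rw [if_neg, zero_smul]
      exact fun hxz => hz (Fin.ext (by omega))
    · simp
  exact LinearMap.congr_fun this γ

theorem coord_blockEmb {n o y : ℕ} (hy : y < n) (hyo : y < o) (γ : K) :
    coord F hy (blockEmb b n o γ) = 0 := by
  have : coord F hy ∘ₗ blockEmb b n o = 0 := by
    refine b.ext fun x => ?_
    simp only [LinearMap.comp_apply, blockEmb_basis, coord_unitVec, LinearMap.zero_apply]
    rw [if_neg (by omega)]
  exact LinearMap.congr_fun this γ

variable {α : K}

theorem blockEmb_pow (hb : ∀ x, b x = α ^ (x : ℕ)) (n o : ℕ) {x : ℕ} (hx : x < m) :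
    blockEmb b n o (α ^ x) = unitVec F n (o + x) := by
  rw [← hb ⟨x, hx⟩, blockEmb_basis]

/-- A functional that vanishes on the multiples `β * α ^ x` of the basis vanishes. -/
theorem functional_eq_zero_of_mul_pow (hb : ∀ x, b x = α ^ (x : ℕ)) {β : K} (hβ : β ≠ 0)
    {φ : K →ₗ[F] F} (h : ∀ x < m, φ (β * α ^ x) = 0) : φ = 0 := by
  have h0 : φ ∘ₗ LinearMap.mulLeft F β = 0 :=
    b.ext fun x => by simpa [hb] using h x x.2
  ext γ
  have := LinearMap.congr_fun h0 (β⁻¹ * γ)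
  simpa [mul_inv_cancel_left₀ hβ] using this

/-- The zeros from position m on stand for the unit rows, which have no entry in the last block. -/
theorem coeff_eq_zero_of_sum_pow (hb : ∀ x, b x = α ^ (x : ℕ)) {t : ℕ} {c : ℕ → F}
    (h : ∑ x ∈ Finset.range t, c x • (if x < m then α ^ x else 0) = 0) {x : ℕ} (hxt : x < t)
    (hxm : x < m) : c x = 0 := by
  have h1 : ∑ x : Fin m, (if (x : ℕ) < t then c x else 0) • b x = 0 := by
    rw [← h]
    simp only [hb, ite_smul, zero_smul, smul_ite, smul_zero]
    rw [Fin.sum_univ_eq_sum_range (fun x => if x < t then c x • α ^ x else 0),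
      ← Finset.sum_filter, ← Finset.sum_filter]
    refine Finset.sum_congr ?_ fun _ _ => rfl
    ext y
    simp [and_comm]
  simpa [hxt] using Fintype.linearIndependent_iff.1 b.linearIndependent _ h1 ⟨x, hxm⟩

end Block

/-! ### The rows of the generator matrices -/

section Rows

variable {F K : Type*} [Field F] [Field K] [Algebra F K] {m : ℕ} {b : Module.Basis (Fin m) F K}
  {n a k : ℕ} {α : K}

/-- The rows of `A_i * g` (for `β = γ`) and of `B_i` (for `β = 0` and `γ = 1`), with row and column
blocks of the widths `a`, `k` and `m`, continued beyond the last row. -/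
def genRow (b : Module.Basis (Fin m) F K) (n a k : ℕ) (α β γ : K) (x : ℕ) : Fin n → F :=
  if x < k then unitVec F n (a + x) + blockEmb b n (a + k) (β * α ^ x)
  else if x < m then blockEmb b n (a + k) (γ * α ^ x)
  else if x < m + a then unitVec F n (x - m)
  else blockEmb b n (a + k) (γ * α ^ (x - (m + a)))

/-- The parameter pairs that belong to a matrix `A_i * g` or `B_i`. -/
def IsGenPair (β γ : K) : Prop := (β = γ ∧ γ ≠ 0) ∨ (β = 0 ∧ γ = 1)

theorem IsGenPair.ne_zero {β γ : K} (h : IsGenPair β γ) : γ ≠ 0 := by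
  rcases h with ⟨-, h⟩ | ⟨-, rfl⟩
  · exact h
  · exact one_ne_zero

variable {β γ : K} {x : ℕ}

theorem genRow_of_lt (hx : x < k) :
    genRow b n a k α β γ x = unitVec F n (a + x) + blockEmb b n (a + k) (β * α ^ x) := by
  rw [genRow, if_pos hx]

theorem genRow_of_mid (hkx : k ≤ x) (hx : x < m) :
    genRow b n a k α β γ x = blockEmb b n (a + k) (γ * α ^ x) := by
  rw [genRow, if_neg (by omega), if_pos hx]

theorem genRow_of_unit (hkm : k ≤ m) (hmx : m ≤ x) (hx : x < m + a) :
    genRow b n a k α β γ x = unitVec F n (x - m) := by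
  rw [genRow, if_neg (by omega), if_neg (by omega), if_pos hx]

theorem genRow_of_last (hkm : k ≤ m) (hx : m + a ≤ x) :
    genRow b n a k α β γ x = blockEmb b n (a + k) (γ * α ^ (x - (m + a))) := by
  rw [genRow, if_neg (by omega), if_neg (by omega), if_neg (by omega)]

/-- The rows of `B_i` are unit vectors. -/
theorem genRow_zero_one (hb : ∀ x, b x = α ^ (x : ℕ)) (hkm : k ≤ m) (hx : x < m + a) :
    genRow b n a k α 0 1 x =
      unitVec F n (if x < k then a + x else if x < m then a + k + x else x - m) := by
  by_cases hxk : x < k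
  · rw [genRow_of_lt hxk, zero_mul, map_zero, add_zero, if_pos hxk]
  by_cases hxm : x < m
  · rw [genRow_of_mid (by omega) hxm, one_mul, blockEmb_pow hb _ _ hxm, if_neg hxk, if_pos hxm]
  · rw [genRow_of_unit hkm (by omega) hx, if_neg hxk, if_neg hxm]

theorem coord_genRow_of_lt (hkm : k ≤ m) (hx : x < m + a) {y : ℕ} (hy : y < n) (hya : y < a) :
    coord F hy (genRow b n a k α β γ x) = if x = y + m then 1 else 0 := by
  by_cases hxk : x < k
  · rw [genRow_of_lt hxk, map_add, coord_unitVec, coord_blockEmb hy (by omega), if_neg (by omega),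
      if_neg (by omega), add_zero]
  by_cases hxm : x < m
  · rw [genRow_of_mid (by omega) hxm, coord_blockEmb hy (by omega), if_neg (by omega)]
  · rw [genRow_of_unit hkm (by omega) hx, coord_unitVec]
    exact if_congr (by omega) rfl rfl

theorem coord_genRow_of_mid (hkm : k ≤ m) (hx : x < m + a) {z : ℕ} (hy : a + z < n) (hz : z < k) :
    coord F hy (genRow b n a k α β γ x) = if x = z then 1 else 0 := by
  by_cases hxk : x < k
  · rw [genRow_of_lt hxk, map_add, coord_unitVec, coord_blockEmb hy (by omega), add_zero]
    exact if_congr (by omega) rfl rfl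
  by_cases hxm : x < m
  · rw [genRow_of_mid (by omega) hxm, coord_blockEmb hy (by omega), if_neg (by omega)]
  · rw [genRow_of_unit hkm (by omega) hx, coord_unitVec, if_neg (by omega), if_neg (by omega)]

theorem blockProj_genRow (hn : a + k + m ≤ n) (hkm : k ≤ m) (hx : x < m + a) :
    blockProj b hn (genRow b n a k α β γ x) =
      if x < k then β * α ^ x else if x < m then γ * α ^ x else 0 := by
  by_cases hxk : x < k
  · rw [genRow_of_lt hxk, map_add, blockProj_unitVec hn (by omega), blockProj_blockEmb, if_pos hxk,
      zero_add]
  by_cases hxm : x < m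
  · rw [genRow_of_mid (by omega) hxm, blockProj_blockEmb, if_neg hxk, if_pos hxm]
  · rw [genRow_of_unit hkm (by omega) hx, blockProj_unitVec hn (by omega), if_neg hxk, if_neg hxm]

variable {t : ℕ} {c : ℕ → F}

/-- Among the first m + a rows, only row y + m meets column y < a, and only row z meets the middle
column a + z. So coefficients can be read off from a combination. -/
theorem coord_sum_of_lt (hkm : k ≤ m) (ht : t ≤ m + a) {y : ℕ} (hy : y < n) (hya : y < a) :
    coord F hy (∑ x ∈ Finset.range t, c x • genRow b n a k α β γ x) =
      if y + m < t then c (y + m) else 0 := by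
  rw [map_sum]
  simp only [map_smul]
  rw [Finset.sum_congr rfl fun x hx => by
    rw [coord_genRow_of_lt hkm (by rw [Finset.mem_range] at hx; omega) hy hya]]
  simp

theorem coord_sum_of_mid (hkm : k ≤ m) (ht : t ≤ m + a) {z : ℕ} (hy : a + z < n) (hz : z < k) :
    coord F hy (∑ x ∈ Finset.range t, c x • genRow b n a k α β γ x) =
      if z < t then c z else 0 := by
  rw [map_sum]
  simp only [map_smul]
  rw [Finset.sum_congr rfl fun x hx => by
    rw [coord_genRow_of_mid hkm (by rw [Finset.mem_range] at hx; omega) hy hz]]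
  simp

/-- The last block of a combination of rows of `A_i * g`. -/
theorem blockProj_sum (hn : a + k + m ≤ n) (hkm : k ≤ m) (ht : t ≤ m + a) :
    blockProj b hn (∑ x ∈ Finset.range t, c x • genRow b n a k α β β x) =
      β * ∑ x ∈ Finset.range t, c x • (if x < m then α ^ x else 0) := by
  rw [map_sum, Finset.mul_sum]
  refine Finset.sum_congr rfl fun x hx => ?_
  rw [Finset.mem_range] at hx
  rw [map_smul, blockProj_genRow hn hkm (by omega), mul_smul_comm]
  congr 1
  split_ifs <;> first | rfl | omega | simp

theorem coeff_eq_zero_of_blockProj (hb : ∀ x, b x = α ^ (x : ℕ)) (hβ : β ≠ 0)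
    (hn : a + k + m ≤ n) (hkm : k ≤ m) (ht : t ≤ m + a)
    (h : blockProj b hn (∑ x ∈ Finset.range t, c x • genRow b n a k α β β x) = 0)
    (hxt : x < t) (hxm : x < m) : c x = 0 := by
  rw [blockProj_sum hn hkm ht] at h
  exact coeff_eq_zero_of_sum_pow hb ((mul_eq_zero.1 h).resolve_left hβ) hxt hxm

/-- Consequences of the vanishing of a functional on the first three blocks of rows. -/
theorem functional_unit (hkm : k ≤ m) {φ : (Fin n → F) →ₗ[F] F}
    (h : ∀ x < m + a, φ (genRow b n a k α β γ x) = 0) {y : ℕ} (hy : y < a) :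
    φ (unitVec F n y) = 0 := by
  have := h (y + m) (by omega)
  rwa [genRow_of_unit hkm (by omega) (by omega), Nat.add_sub_cancel] at this

theorem functional_top (hb : ∀ x, b x = α ^ (x : ℕ)) (hn : a + k + m = n)
    {φ : (Fin n → F) →ₗ[F] F} (h1 : ∀ y < a, φ (unitVec F n y) = 0)
    (h2 : ∀ x < k, φ (unitVec F n (a + x)) = 0) (h3 : φ ∘ₗ blockEmb b n (a + k) = 0) : φ = 0 := by
  refine functional_eq_zero fun y hy => ?_
  by_cases hya : y < a
  · exact h1 y hya
  by_cases hyk : y < a + k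
  · have := h2 (y - a) (by omega)
    rwa [Nat.add_sub_cancel' (by omega)] at this
  · have := LinearMap.congr_fun h3 (α ^ (y - (a + k)))
    rwa [LinearMap.comp_apply, blockEmb_pow hb _ _ (by omega), Nat.add_sub_cancel' (by omega)]
      at this

/-- The multiples γ α ^ x with k ≤ x < m are rows of the second block, those with x < k are the
closing rows. The vector missing from the matrix is the one with x = k - 1. -/
theorem prefixSpan_genRow_top (hb : ∀ x, b x = α ^ (x : ℕ)) (hn : a + k + m = n) (hkm : k ≤ m)
    (hγ : γ ≠ 0) : prefixSpan F (genRow b n a k α β γ) n = ⊤ := by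
  refine eq_top_of_forall_functional fun φ hφ => ?_
  have h : ∀ x < n, φ (genRow b n a k α β γ x) = 0 := fun x hx => hφ _ (apply_mem_prefixSpan hx)
  have h3 : φ ∘ₗ blockEmb b n (a + k) = 0 := by
    refine functional_eq_zero_of_mul_pow hb hγ fun x hx => ?_
    by_cases hxk : x < k
    · have := h (m + a + x) (by omega)
      rwa [genRow_of_last hkm (by omega), Nat.add_sub_cancel_left] at this
    · have := h x (by omega)
      rwa [genRow_of_mid (by omega) hx] at this
  refine functional_top hb hn (fun y hy => functional_unit hkm (fun x hx => h x (by omega)) hy)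
    (fun x hx => ?_) h3
  have := h x (by omega)
  rwa [genRow_of_lt hx, map_add, show φ (blockEmb b n (a + k) (β * α ^ x)) = 0 from
    LinearMap.congr_fun h3 _, add_zero] at this

theorem finrank_prefixSpan_genRow (hb : ∀ x, b x = α ^ (x : ℕ)) (hn : a + k + m = n) (hkm : k ≤ m)
    (hγ : γ ≠ 0) (ht : t ≤ n) :
    Module.finrank F ↥(prefixSpan F (genRow b n a k α β γ) t) = t :=
  finrank_prefixSpan (by simpa using prefixSpan_genRow_top hb hn hkm hγ) (by simpa using ht)

/-! #### Two generators with the same index `i` -/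

/-- The middle block gives c = c' below k. If also c = c' up to m and c = 0 from m on, comparing
last blocks gives (β - β') ∑ c_x α ^ x = 0, hence c = 0. -/
theorem finrank_inf_same_le (hb : ∀ x, b x = α ^ (x : ℕ)) (hn : a + k + m = n) (hkm : k ≤ m)
    {β' : K} (hββ : β ≠ β') (ht : t ≤ m + a) :
    Module.finrank F ↥(prefixSpan F (genRow b n a k α β β) t ⊓
      prefixSpan F (genRow b n a k α β' β') t) ≤ t - k := by
  -- One condition for each position from k to t - 1: equality of the coefficients below m,
  -- vanishing of the first one from m on.
  let L : ((ℕ → F) × (ℕ → F)) →ₗ[F] (Fin (t - k) → F) := LinearMap.pi fun z =>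
    if k + z < m then
      LinearMap.proj (k + (z : ℕ)) ∘ₗ (LinearMap.fst F _ _ - LinearMap.snd F _ _)
    else LinearMap.proj (k + (z : ℕ)) ∘ₗ LinearMap.fst F _ _
  refine finrank_prefixSpan_inf_le L fun c c' hcc hL => ?_
  have h1 : ∀ x < t, x < m → c x = c' x := by
    intro x hxt hxm
    by_cases hxk : x < k
    · have := congrArg (coord F (show a + x < n by omega)) hcc
      rwa [coord_sum_of_mid hkm ht _ hxk, coord_sum_of_mid hkm ht _ hxk, if_pos hxt,
        if_pos hxt] at this
    · have := congrFun hL ⟨x - k, by omega⟩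
      have hx : k + (x - k) = x := by omega
      simpa [L, hx, hxm, sub_eq_zero] using this
  have h2 : ∀ x < t, m ≤ x → c x = 0 := by
    intro x hxt hxm
    have := congrFun hL ⟨x - k, by omega⟩
    have hx : k + (x - k) = x := by omega
    simpa [L, hx, not_lt.2 hxm] using this
  have h3 : ∑ x ∈ Finset.range t, c' x • (if x < m then α ^ x else 0) =
      ∑ x ∈ Finset.range t, c x • (if x < m then α ^ x else 0) := by
    refine Finset.sum_congr rfl fun x hx => ?_
    by_cases hxm : x < m
    · rw [h1 x (Finset.mem_range.1 hx) hxm]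
    · rw [if_neg hxm, smul_zero, smul_zero]
  have h4 := congrArg (blockProj b hn.le) hcc
  rw [blockProj_sum hn.le hkm ht, blockProj_sum hn.le hkm ht, h3, ← sub_eq_zero, ← sub_mul] at h4
  have h5 := (mul_eq_zero.1 h4).resolve_left (sub_ne_zero.2 hββ)
  refine Finset.sum_eq_zero fun x hx => ?_
  rw [Finset.mem_range] at hx
  by_cases hxm : x < m
  · rw [coeff_eq_zero_of_sum_pow hb h5 hx hxm, zero_smul]
  · rw [h2 x hx (by omega), zero_smul]

/-- The linear map that reads off coefficients of the second sequence. -/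
def sndCoeffs (F : Type*) [Field F] {d : ℕ} (g : Fin d → ℕ) :
    ((ℕ → F) × (ℕ → F)) →ₗ[F] (Fin d → F) :=
  (LinearMap.pi fun z => LinearMap.proj (g z)) ∘ₗ LinearMap.snd F _ _

theorem sndCoeffs_eq_zero {d : ℕ} {g : Fin d → ℕ} {c c' : ℕ → F}
    (h : sndCoeffs F g (c, c') = 0) (z : ℕ) (hz : z < d) : c' (g ⟨z, hz⟩) = 0 :=
  congrFun h ⟨z, hz⟩

theorem sum_eq_zero_of_coeff {E : Type*} [AddCommGroup E] [Module F E] {w : ℕ → E}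
    (h : ∀ x < t, c x = 0) : ∑ x ∈ Finset.range t, c x • w x = 0 :=
  Finset.sum_eq_zero fun x hx => by rw [h x (Finset.mem_range.1 hx), zero_smul]

/-- The first k rows of B_i have no entry in the last block. Once the other coefficients of B_i
vanish, independence of the β α ^ x kills those of A_i g below m, and the identity block kills the
rest. -/
theorem finrank_inf_same_zero_le (hb : ∀ x, b x = α ^ (x : ℕ)) (hn : a + k + m = n) (hkm : k ≤ m)
    (hβ : β ≠ 0) (ht : t ≤ m + a) :
    Module.finrank F ↥(prefixSpan F (genRow b n a k α β β) t ⊓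
      prefixSpan F (genRow b n a k α 0 1) t) ≤ t - k := by
  refine finrank_prefixSpan_inf_le (sndCoeffs F fun z => k + z) fun c c' hcc hL => ?_
  have h1 : ∀ x < t, k ≤ x → c' x = 0 := by
    intro x hxt hxk
    have := sndCoeffs_eq_zero hL (x - k) (by omega)
    rwa [show k + (x - k) = x by omega] at this
  have h2 : blockProj b hn.le (∑ x ∈ Finset.range t, c' x • genRow b n a k α 0 1 x) = 0 := by
    rw [map_sum]
    refine Finset.sum_eq_zero fun x hx => ?_
    rw [Finset.mem_range] at hx
    by_cases hxk : x < k
    · rw [map_smul, blockProj_genRow hn.le hkm (by omega), if_pos hxk, zero_mul, smul_zero]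
    · rw [h1 x hx (by omega), zero_smul, map_zero]
  rw [← hcc] at h2
  refine sum_eq_zero_of_coeff fun x hx => ?_
  by_cases hxm : x < m
  · exact coeff_eq_zero_of_blockProj hb hβ hn.le hkm ht h2 hx hxm
  · have := congrArg (coord F (show x - m < n by omega)) hcc
    rw [coord_sum_of_lt hkm ht _ (by omega), coord_sum_of_lt hkm ht _ (by omega),
      show x - m + m = x by omega, if_pos hx, if_pos hx, h1 x hx (by omega)] at this
    exact this

/-- Subtracting the first k rows of the two generators removes the middle block and leaves (β - β')
α ^ x. Together with the second block of rows, this yields a multiple of the whole basis of K. -/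
theorem sup_eq_top_same (hb : ∀ x, b x = α ^ (x : ℕ)) (hn : a + k + m = n) (hkm : k ≤ m)
    {β' γ' : K} (h1 : IsGenPair β γ) (h2 : IsGenPair β' γ') (hββ : β ≠ β') :
    prefixSpan F (genRow b n a k α β γ) (m + a) ⊔ prefixSpan F (genRow b n a k α β' γ') (m + a) =
      ⊤ := by
  refine eq_top_of_forall_functional fun φ hφ => ?_
  have e1 : ∀ x < m + a, φ (genRow b n a k α β γ x) = 0 := fun x hx =>
    hφ _ (Submodule.mem_sup_left (apply_mem_prefixSpan hx))
  have e2 : ∀ x < m + a, φ (genRow b n a k α β' γ' x) = 0 := fun x hx =>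
    hφ _ (Submodule.mem_sup_right (apply_mem_prefixSpan hx))
  set ψ := φ ∘ₗ blockEmb b n (a + k) with hψ
  have l1 : ∀ x < k, φ (unitVec F n (a + x)) + ψ (β * α ^ x) = 0 := by
    intro x hx
    rw [← e1 x (by omega), genRow_of_lt hx, map_add]
    rfl
  have l2 : ∀ x < k, φ (unitVec F n (a + x)) + ψ (β' * α ^ x) = 0 := by
    intro x hx
    rw [← e2 x (by omega), genRow_of_lt hx, map_add]
    rfl
  have l3 : ∀ x < m, k ≤ x → ψ (γ * α ^ x) = 0 := by
    intro x hx hkx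
    rw [← e1 x (by omega), genRow_of_mid hkx hx]
    rfl
  have l4 : ∀ x < m, k ≤ x → ψ (γ' * α ^ x) = 0 := by
    intro x hx hkx
    rw [← e2 x (by omega), genRow_of_mid hkx hx]
    rfl
  have hψ0 : ψ = 0 := by
    have key : ∀ δ : K, δ ≠ 0 → (∀ x < k, ψ (δ * α ^ x) = 0) →
        (∀ x < m, k ≤ x → ψ (δ * α ^ x) = 0) → ψ = 0 := fun δ hδ f1 f2 =>
      functional_eq_zero_of_mul_pow hb hδ fun x hx =>
        (lt_or_ge x k).elim (fun hxk => f1 x hxk) fun hxk => f2 x hx hxk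
    have hlow : ∀ x < k, ψ ((β - β') * α ^ x) = 0 := by
      intro x hx
      rw [sub_mul, map_sub, sub_eq_zero]
      exact add_left_cancel ((l1 x hx).trans (l2 x hx).symm)
    rcases h1 with ⟨rfl, hβ⟩ | ⟨rfl, rfl⟩
    · rcases h2 with ⟨rfl, hβ'⟩ | ⟨rfl, rfl⟩
      · refine key _ (sub_ne_zero.2 hββ) hlow fun x hx hkx => ?_
        rw [sub_mul, map_sub, l3 x hx hkx, l4 x hx hkx, sub_zero]
      · refine key _ hβ (fun x hx => ?_) l3
        simpa using hlow x hx
    · rcases h2 with ⟨rfl, hβ'⟩ | ⟨rfl, rfl⟩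
      · refine key _ hβ' (fun x hx => ?_) l4
        simpa using hlow x hx
      · exact absurd rfl hββ
  refine functional_top hb hn (fun y hy => functional_unit hkm e1 hy) (fun x hx => ?_) hψ0
  simpa [hψ0] using l1 x hx

end Rows

section TwoIndices

variable {F K K' : Type*} [Field F] [Field K] [Algebra F K] [Field K'] [Algebra F K'] {m m' : ℕ}
  {b : Module.Basis (Fin m) F K} {b' : Module.Basis (Fin m') F K'} {n a a' k h t : ℕ}
  {α β γ : K} {α' β' γ' : K'}

/-! #### Two generators with different indices `i < i'` -/

/-- Column a' + x with x < k is a middle column of the second generator and an identity column of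
the first. There the first generator has its entry in row m + a' + x ≥ t, so c' vanishes below k. -/
theorem finrank_inf_lt_le (hn : a + k + m = n) (hn' : a' + k + m' = n) (hkm : k ≤ m)
    (hkm' : k ≤ m') (haa : a' + k ≤ a) (ht : t ≤ m + a') (ht' : t ≤ m') :
    Module.finrank F ↥(prefixSpan F (genRow b n a k α β γ) t ⊓
      prefixSpan F (genRow b' n a' k α' β' γ') t) ≤ t - k := by
  refine finrank_prefixSpan_inf_le (sndCoeffs F fun z => k + z) fun c c' hcc hL => ?_
  rw [hcc]
  refine sum_eq_zero_of_coeff fun x hx => ?_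
  by_cases hxk : x < k
  · have := congrArg (coord F (show a' + x < n by omega)) hcc
    rw [coord_sum_of_lt hkm (by omega) _ (by omega), coord_sum_of_mid hkm' (by omega) _ hxk,
      if_pos hx, if_neg (by omega)] at this
    exact this.symm
  · have := sndCoeffs_eq_zero hL (x - k) (by omega)
    rwa [show k + (x - k) = x by omega] at this

/-- Used for indices 3 and 1: from row m on, the index 1 generator has unit vectors in the first k
columns, outside the last block of A_3 g. Removing the m rows before them forces that block to
vanish. -/
theorem finrank_inf_outer_mul_le (hb' : ∀ x, b' x = α' ^ (x : ℕ)) (hn' : k + m' = n)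
    (hkm : k ≤ m) (hkm' : k ≤ m') (ht : t ≤ m + k) (hka : k ≤ a) (ht' : t ≤ m') (hβ' : β' ≠ 0) :
    Module.finrank F ↥(prefixSpan F (genRow b' n 0 k α' β' β') t ⊓
      prefixSpan F (genRow b n a k α β γ) t) ≤ m := by
  refine finrank_prefixSpan_inf_le (sndCoeffs F fun z => z) fun c c' hcc hL => ?_
  have h1 : ∀ x < m, c' x = 0 := sndCoeffs_eq_zero hL
  have h2 : blockProj b' (show 0 + k + m' ≤ n by omega)
      (∑ x ∈ Finset.range t, c' x • genRow b n a k α β γ x) = 0 := by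
    rw [map_sum]
    refine Finset.sum_eq_zero fun x hx => ?_
    rw [Finset.mem_range] at hx
    by_cases hxm : x < m
    · rw [h1 x hxm, zero_smul, map_zero]
    · rw [map_smul, genRow_of_unit hkm (by omega) (by omega), blockProj_unitVec _ (by omega),
        smul_zero]
  rw [← hcc] at h2
  exact sum_eq_zero_of_coeff fun x hx =>
    coeff_eq_zero_of_blockProj hb' hβ' _ hkm' (by omega) h2 hx (by omega)

/-- The rows k ≤ x < 2k of B_3 occupy the columns 2k, …, 3k - 1, to the left of the last block of
A_1 g. It suffices to kill the other k + h coefficients of B_3. -/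
theorem finrank_inf_outer_unit_mul_le (hb : ∀ x, b x = α ^ (x : ℕ))
    (hb' : ∀ x, b' x = α' ^ (x : ℕ)) (hn : 2 * k + k + m = n) (hn' : k + m' = n) (hm : m = k + h)
    (hβ : β ≠ 0) :
    Module.finrank F ↥(prefixSpan F (genRow b n (2 * k) k α β β) (2 * k + h) ⊓
      prefixSpan F (genRow b' n 0 k α' 0 1) (2 * k + h)) ≤ k + h := by
  refine finrank_prefixSpan_inf_le (sndCoeffs F fun z => if (z : ℕ) < k then z else k + z)
    fun c c' hcc hL => ?_
  have h1 : ∀ x < k, c' x = 0 := by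
    intro x hx
    have := sndCoeffs_eq_zero hL x (by omega)
    rwa [if_pos hx] at this
  have h2 : ∀ x < 2 * k + h, 2 * k ≤ x → c' x = 0 := by
    intro x hx hkx
    have := sndCoeffs_eq_zero hL (x - k) (by omega)
    rwa [if_neg (show ¬ x - k < k by omega), show k + (x - k) = x by omega] at this
  have h3 : blockProj b hn.le
      (∑ x ∈ Finset.range (2 * k + h), c' x • genRow b' n 0 k α' 0 1 x) = 0 := by
    rw [map_sum]
    refine Finset.sum_eq_zero fun x hx => ?_
    rw [Finset.mem_range] at hx
    by_cases hxk : x < k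
    · rw [h1 x hxk, zero_smul, map_zero]
    by_cases hx2 : x < 2 * k
    · rw [map_smul, genRow_zero_one hb' (by omega) (by omega), if_neg hxk, if_pos (by omega),
        blockProj_unitVec _ (by omega), smul_zero]
    · rw [h2 x hx (by omega), zero_smul, map_zero]
  rw [← hcc] at h3
  refine sum_eq_zero_of_coeff fun x hx => ?_
  by_cases hxm : x < m
  · exact coeff_eq_zero_of_blockProj hb hβ _ (by omega) (by omega) h3 hx hxm
  · have := congrArg (coord F (show 0 + (x - m) < n by omega)) hcc
    rwa [coord_sum_of_lt (by omega) (by omega) _ (by omega),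
      coord_sum_of_mid (by omega) (by omega) _ (by omega),
      show 0 + (x - m) + m = x by omega, if_pos hx, if_pos (by omega), h1 _ (by omega)] at this

/-- Both spans are coordinate subspaces. The rows 2k ≤ x < 2k + h of B_3 give the columns 3k, …, 3k
+ h - 1, which B_1 misses as h < k. -/
theorem finrank_inf_outer_unit_unit_le (hb : ∀ x, b x = α ^ (x : ℕ))
    (hb' : ∀ x, b' x = α' ^ (x : ℕ)) (hn : 2 * k + k + m = n) (hn' : k + m' = n) (hm : m = k + h)
    (hhk : h < k) :
    Module.finrank F ↥(prefixSpan F (genRow b n (2 * k) k α 0 1) (2 * k + h) ⊓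
      prefixSpan F (genRow b' n 0 k α' 0 1) (2 * k + h)) ≤ 2 * k := by
  refine finrank_prefixSpan_inf_le (sndCoeffs F fun z => z) fun c c' hcc hL => ?_
  have h1 : ∀ x < 2 * k, c' x = 0 := sndCoeffs_eq_zero hL
  rw [hcc]
  refine sum_eq_zero_of_coeff fun x hx => ?_
  by_cases hxk : x < 2 * k
  · exact h1 x hxk
  have := congrArg (coord F (show k + x < n by omega)) hcc
  rw [map_sum, map_sum, Finset.sum_eq_zero, Finset.sum_eq_single x] at this
  · rwa [map_smul, genRow_zero_one hb' (by omega) (by omega), coord_unitVec,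
      if_neg (show ¬ x < k by omega), if_pos (show x < m' by omega), if_pos (by omega),
      smul_eq_mul, mul_one, eq_comm] at this
  · intro z hz hzx
    rw [Finset.mem_range] at hz
    by_cases hzk : z < 2 * k
    · rw [h1 z hzk, zero_smul, map_zero]
    · rw [map_smul, genRow_zero_one hb' (by omega) (by omega), coord_unitVec, if_neg, smul_zero]
      split_ifs <;> omega
  · exact fun hx' => absurd (Finset.mem_range.2 hx) hx'
  · intro z hz
    rw [Finset.mem_range] at hz
    rw [map_smul, genRow_zero_one hb (by omega) (by omega), coord_unitVec, if_neg, smul_zero]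
    split_ifs <;> omega

/-- The identity columns of the first generator cover the middle columns of the second, so the
latter's first k rows reduce to their last blocks. For B these are zero, and its second block of
rows gives the columns from a + k on; the first k rows of the first generator supply the rest. -/
theorem sup_eq_top_lt (hb' : ∀ x, b' x = α' ^ (x : ℕ)) (hn : a + k + m = n)
    (hn' : a' + k + m' = n) (hkm : k ≤ m) (haa : a' + k ≤ a)
    (h' : IsGenPair β' γ') :
    prefixSpan F (genRow b n a k α β γ) (m + a) ⊔
      prefixSpan F (genRow b' n a' k α' β' γ') (m + a) = ⊤ := by
  refine eq_top_of_forall_functional fun φ hφ => ?_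
  have e1 : ∀ x < m + a, φ (genRow b n a k α β γ x) = 0 := fun x hx =>
    hφ _ (Submodule.mem_sup_left (apply_mem_prefixSpan hx))
  have e2 : ∀ x < m' + a', φ (genRow b' n a' k α' β' γ' x) = 0 := fun x hx =>
    hφ _ (Submodule.mem_sup_right (apply_mem_prefixSpan (by omega)))
  have hlow : ∀ y < a, φ (unitVec F n y) = 0 := fun y hy => functional_unit hkm e1 hy
  set ψ := φ ∘ₗ blockEmb b' n (a' + k) with hψ
  have l1 : ∀ x < k, ψ (β' * α' ^ x) = 0 := by
    intro x hx
    have := e2 x (by omega)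
    rwa [genRow_of_lt hx, map_add, hlow _ (by omega), zero_add] at this
  have l2 : ∀ x < m', k ≤ x → ψ (γ' * α' ^ x) = 0 := by
    intro x hx hkx
    have := e2 x (by omega)
    rwa [genRow_of_mid hkx hx] at this
  rcases h' with ⟨rfl, hβ⟩ | ⟨rfl, rfl⟩
  · refine functional_top hb' hn' (fun y hy => hlow y (by omega)) (fun x hx => hlow _ (by omega)) ?_
    exact functional_eq_zero_of_mul_pow hb' hβ fun x hx =>
      (lt_or_ge x k).elim (fun hxk => l1 x hxk) fun hxk => l2 x hx hxk
  · have hhigh : ∀ y < n, a + k ≤ y → φ (unitVec F n y) = 0 := by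
      intro y hy hay
      have := l2 (y - (a' + k)) (by omega) (by omega)
      rwa [one_mul, hψ, LinearMap.comp_apply, blockEmb_pow hb' _ _ (by omega),
        show a' + k + (y - (a' + k)) = y by omega] at this
    have hemb : φ ∘ₗ blockEmb b n (a + k) = 0 := by
      refine b.ext fun x => ?_
      rw [LinearMap.comp_apply, blockEmb_basis, hhigh _ (by omega) (by omega),
        LinearMap.zero_apply]
    refine functional_eq_zero fun y hy => ?_
    by_cases hya : y < a
    · exact hlow y hya
    by_cases hyk : y < a + k
    · have := e1 (y - a) (by omega)
      rwa [genRow_of_lt (by omega), map_add, show a + (y - a) = y by omega,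
        show φ (blockEmb b n (a + k) (β * α ^ (y - a))) = 0 from LinearMap.congr_fun hemb _,
        add_zero] at this
    · exact hhigh y hy (by omega)

/-! #### The generator `M` -/

/-- The rows of `M`. -/
def lastRow (F : Type*) [Field F] (n x : ℕ) : Fin n → F := unitVec F n (n - 1 - x)

theorem finrank_prefixSpan_lastRow (ht : t ≤ n) :
    Module.finrank F ↥(prefixSpan F (lastRow F n) t) = t := by
  refine finrank_prefixSpan ?_ (by simpa using ht)
  rw [Module.finrank_fin_fun]
  refine eq_top_of_forall_functional fun φ hφ => functional_eq_zero fun y hy => ?_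
  have := hφ _ (apply_mem_prefixSpan (show n - 1 - y < n by omega))
  rwa [lastRow, show n - 1 - (n - 1 - y) = y by omega] at this

theorem coord_sum_lastRow {c : ℕ → F} (ht : t ≤ n) {y : ℕ} (hy : y < n) (hyt : y < n - t) :
    coord F hy (∑ x ∈ Finset.range t, c x • lastRow F n x) = 0 := by
  rw [map_sum]
  refine Finset.sum_eq_zero fun x hx => ?_
  rw [Finset.mem_range] at hx
  rw [map_smul, lastRow, coord_unitVec, if_neg (by omega), smul_zero]

/-- The first t rows of M vanish in the columns below n - t, which include the middle block. -/
theorem finrank_inf_lastRow_le (hkm : k ≤ m) (hk : a + k ≤ n - t) (ht : t ≤ m + a)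
    (hn : a + k + m = n) :
    Module.finrank F ↥(prefixSpan F (lastRow F n) t ⊓
      prefixSpan F (genRow b n a k α β γ) t) ≤ t - k := by
  refine finrank_prefixSpan_inf_le (sndCoeffs F fun z => k + z) fun c c' hcc hL => ?_
  rw [hcc]
  refine sum_eq_zero_of_coeff fun x hx => ?_
  by_cases hxk : x < k
  · have := congrArg (coord F (show a + x < n by omega)) hcc
    rw [coord_sum_of_mid hkm ht _ hxk, coord_sum_lastRow (by omega) _ (by omega), if_pos hx] at this
    exact this.symm
  · have := sndCoeffs_eq_zero hL (x - k) (by omega)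
    rwa [show k + (x - k) = x by omega] at this

/-- Here only the identity columns are known to lie below n - t, so the coefficients from m on
vanish. This handles index 1 in dimension 2k + h. -/
theorem finrank_inf_lastRow_le' (hkm : k ≤ m) (ha : a ≤ n - t) (ht : t ≤ m + a)
    (hn : a + k + m = n) :
    Module.finrank F ↥(prefixSpan F (lastRow F n) t ⊓
      prefixSpan F (genRow b n a k α β γ) t) ≤ m := by
  refine finrank_prefixSpan_inf_le (sndCoeffs F fun z => z) fun c c' hcc hL => ?_
  rw [hcc]
  refine sum_eq_zero_of_coeff fun x hx => ?_
  by_cases hxm : x < m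
  · exact sndCoeffs_eq_zero hL x hxm
  · have := congrArg (coord F (show x - m < n by omega)) hcc
    rw [coord_sum_of_lt hkm ht _ (by omega), coord_sum_lastRow (by omega) _ (by omega),
      show x - m + m = x by omega, if_pos hx] at this
    exact this.symm

theorem sup_eq_top_lastRow (hkm : k ≤ m) (hn : a + k + m = n) (ha : k ≤ a ∨ a = 0) :
    prefixSpan F (lastRow F n) (m + a) ⊔ prefixSpan F (genRow b n a k α β γ) (m + a) = ⊤ := by
  refine eq_top_of_forall_functional fun φ hφ => ?_
  have e1 : ∀ x < m + a, φ (genRow b n a k α β γ x) = 0 := fun x hx =>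
    hφ _ (Submodule.mem_sup_right (apply_mem_prefixSpan hx))
  have e2 : ∀ y < n, k ≤ y → φ (unitVec F n y) = 0 := by
    intro y hy hky
    have := hφ _ (Submodule.mem_sup_left
      (apply_mem_prefixSpan (show n - 1 - y < m + a by omega)))
    rwa [lastRow, show n - 1 - (n - 1 - y) = y by omega] at this
  have hemb : φ ∘ₗ blockEmb b n (a + k) = 0 := by
    refine b.ext fun x => ?_
    rw [LinearMap.comp_apply, blockEmb_basis, e2 _ (by omega) (by omega), LinearMap.zero_apply]
  refine functional_eq_zero fun y hy => ?_
  by_cases hyk : k ≤ y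
  · exact e2 y hy hyk
  rcases ha with ha | rfl
  · exact functional_unit hkm e1 (by omega)
  · have := e1 y (by omega)
    rwa [genRow_of_lt (by omega), map_add, Nat.zero_add,
      show φ (blockEmb b n (0 + k) (β * α ^ y)) = 0 from LinearMap.congr_fun hemb _,
      add_zero] at this

/-! #### The relation between the flags of two different generators -/

/-- The spans of the rows of two generators are far apart in the dimensions that the theorem
considers. -/
structure FarApart (k h : ℕ) (w w' : ℕ → Fin n → F) : Prop where
  finrank_inf_le : ∀ t ≤ k + h,
    Module.finrank F ↥(prefixSpan F w t ⊓ prefixSpan F w' t) ≤ t - k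
  finrank_inf_mid_le :
    Module.finrank F ↥(prefixSpan F w (2 * k + h) ⊓ prefixSpan F w' (2 * k + h)) ≤ 2 * k
  sup_eq_top : prefixSpan F w (3 * k + h) ⊔ prefixSpan F w' (3 * k + h) = ⊤

theorem FarApart.symm {w w' : ℕ → Fin n → F} (hw : FarApart k h w w') : FarApart k h w' w where
  finrank_inf_le t ht := by rw [inf_comm]; exact hw.finrank_inf_le t ht
  finrank_inf_mid_le := by rw [inf_comm]; exact hw.finrank_inf_mid_le
  sup_eq_top := by rw [sup_comm]; exact hw.sup_eq_top

theorem farApart_same {β' γ' : K} (hb : ∀ x, b x = α ^ (x : ℕ)) (hn : a + k + m = n)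
    (hma : m + a = 3 * k + h) (hkm : k + h ≤ m) (hhk : h < k) (h1 : IsGenPair β γ)
    (h2 : IsGenPair β' γ') (hββ : β ≠ β') :
    FarApart k h (genRow b n a k α β γ) (genRow b n a k α β' γ') := by
  have key : ∀ t ≤ m + a, Module.finrank F ↥(prefixSpan F (genRow b n a k α β γ) t ⊓
      prefixSpan F (genRow b n a k α β' γ') t) ≤ t - k := by
    intro t ht
    rcases h1 with ⟨rfl, hβ⟩ | ⟨rfl, rfl⟩
    · rcases h2 with ⟨rfl, hβ'⟩ | ⟨rfl, rfl⟩
      · exact finrank_inf_same_le hb hn (by omega) hββ ht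
      · exact finrank_inf_same_zero_le hb hn (by omega) hβ ht
    · rcases h2 with ⟨rfl, hβ'⟩ | ⟨rfl, rfl⟩
      · rw [inf_comm]
        exact finrank_inf_same_zero_le hb hn (by omega) hβ' ht
      · exact absurd rfl hββ
  exact ⟨fun t ht => key t (by omega), (key _ (by omega)).trans (by omega),
    hma ▸ sup_eq_top_same hb hn (by omega) h1 h2 hββ⟩

/-- In `hmid`, the first alternative covers the index pairs (1, 2) and (2, 3), the second one the
pair (1, 3). -/
theorem farApart_lt (hb : ∀ x, b x = α ^ (x : ℕ)) (hb' : ∀ x, b' x = α' ^ (x : ℕ))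
    (hn : a + k + m = n) (hn' : a' + k + m' = n) (hma : m + a = 3 * k + h) (hkm : k + h ≤ m)
    (hhk : h < k) (haa : a' + k ≤ a) (h1 : IsGenPair β γ) (h2 : IsGenPair β' γ')
    (hmid : 2 * k + h ≤ m + a' ∨ (a = 2 * k ∧ a' = 0)) :
    FarApart k h (genRow b n a k α β γ) (genRow b' n a' k α' β' γ') where
  finrank_inf_le t ht := finrank_inf_lt_le hn hn' (by omega) (by omega) haa (by omega) (by omega)
  finrank_inf_mid_le := by
    rcases hmid with hmid | ⟨rfl, rfl⟩
    · exact (finrank_inf_lt_le hn hn' (by omega) (by omega) haa hmid (by omega)).trans (by omega)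
    rcases h2 with ⟨rfl, hβ'⟩ | ⟨rfl, rfl⟩
    · rw [inf_comm]
      exact (finrank_inf_outer_mul_le hb' (by omega) (by omega) (by omega) (by omega) (by omega)
        (by omega) hβ').trans (by omega)
    rcases h1 with ⟨rfl, hβ⟩ | ⟨rfl, rfl⟩
    · exact (finrank_inf_outer_unit_mul_le hb hb' hn (by omega) (by omega) hβ).trans (by omega)
    · exact finrank_inf_outer_unit_unit_le hb hb' hn (by omega) (by omega) hhk
  sup_eq_top := hma ▸ sup_eq_top_lt hb' hn hn' (by omega) haa h2

theorem farApart_lastRow (hn : a + k + m = n) (hma : m + a = 3 * k + h) (hkm : k + h ≤ m)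
    (hhk : h < k) (ha : a = 2 * k ∨ a = k ∨ a = 0) :
    FarApart k h (lastRow F n) (genRow b n a k α β γ) where
  finrank_inf_le t ht := finrank_inf_lastRow_le (by omega) (by omega) (by omega) hn
  finrank_inf_mid_le := by
    by_cases hak : a ≤ k
    · exact (finrank_inf_lastRow_le (by omega) (by omega) (by omega) hn).trans (by omega)
    · exact (finrank_inf_lastRow_le' (by omega) (by omega) (by omega) hn).trans (by omega)
  sup_eq_top := hma ▸ sup_eq_top_lastRow (by omega) hn (by omega)

end TwoIndices

/-! ### The generator matrices and their rows -/

section Matrices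

variable {F : Type*} [Field F] {n m : ℕ}

/-- The matrix whose rows are the first `n - 1` terms of a sequence of vectors. -/
def rowsMatrix (w : ℕ → Fin n → F) : Matrix (Fin (n - 1)) (Fin n) F :=
  Matrix.of fun x => w x

theorem initialRowSpace_rowsMatrix (w : ℕ → Fin n → F) {t : ℕ} (ht : t ≤ n - 1) :
    initialRowSpace (rowsMatrix w) t = prefixSpan F w t := by
  unfold initialRowSpace prefixSpan
  congr 1
  ext v
  constructor
  · rintro ⟨x, hx, rfl⟩
    exact ⟨x, by simpa using hx, rfl⟩
  · rintro ⟨x, hx, rfl⟩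
    have hxt : x < t := by simpa using hx
    exact ⟨⟨x, by omega⟩, hxt, rfl⟩

theorem rowSpace_rowsMatrix (w : ℕ → Fin n → F) :
    rowSpace (rowsMatrix w) = prefixSpan F w (n - 1) := by
  rw [← initialRowSpace_rowsMatrix w le_rfl, rowSpace, initialRowSpace]
  congr 1
  rw [← Set.image_univ]
  congr 1
  ext x
  simp

theorem unitVec_vecMul (G : Matrix (Fin n) (Fin n) F) {y : ℕ} (hy : y < n) :
    Matrix.vecMul (unitVec F n y) G = G ⟨y, hy⟩ := by
  have : unitVec F n y = Pi.single ⟨y, hy⟩ 1 := by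
    ext z
    simp [unitVec, Pi.single_apply, Fin.ext_iff]
  rw [this, Matrix.single_one_vecMul]
  rfl

theorem blockDiag_row_of_lt {o : ℕ} (X : Matrix (Fin m) (Fin m) F) {y : ℕ} (hy : y < n)
    (hyo : y < o) : blockDiag n o X ⟨y, hy⟩ = unitVec F n y := by
  ext z
  rw [blockDiag, Matrix.of_apply, dif_neg (fun hc => absurd hc.1.1 (not_le.2 hyo)), unitVec]
  exact if_congr (by rw [Fin.ext_iff, eq_comm]) rfl rfl

theorem blockDiag_row_of_ge {o : ℕ} (X : Matrix (Fin m) (Fin m) F) (z : Fin m)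
    (hz : o + z < n) :
    blockDiag n o X ⟨o + z, hz⟩ = ∑ u : Fin m, X z u • unitVec F n (o + u) := by
  ext v
  rw [Finset.sum_apply, blockDiag, Matrix.of_apply]
  by_cases hv : o ≤ (v : ℕ) ∧ (v : ℕ) - o < m
  · rw [dif_pos ⟨⟨Nat.le_add_right _ _, by simp⟩, hv⟩, Finset.sum_eq_single ⟨v - o, hv.2⟩]
    · have h1 : (v : ℕ) = o + (v - o) := by omega
      simp only [Nat.add_sub_cancel_left, Pi.smul_apply, unitVec]
      rw [if_pos h1, smul_eq_mul, mul_one]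
    · intro u _ hu
      have h1 : ¬ (v : ℕ) = o + u := fun h => hu (Fin.ext (by simp [h]))
      simp [unitVec, h1]
    · simp
  · rw [dif_neg (fun hc => hv hc.2), if_neg, Finset.sum_eq_zero]
    · intro u _
      have h1 : ¬ (v : ℕ) = o + u := fun h => hv ⟨by omega, by omega⟩
      simp [unitVec, h1]
    · intro h
      have : o + (z : ℕ) = v := congrArg Fin.val h
      exact hv ⟨by omega, by omega⟩

variable {f : F[X]}

/-- The powers of the root, as a basis of `F[X] / (f)`. -/
def rootBasis (hf : f.Monic) (hm : f.natDegree = m) : Module.Basis (Fin m) F (AdjoinRoot f) :=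
  (AdjoinRoot.powerBasis' hf).basis.reindex
    (finCongr ((AdjoinRoot.powerBasis'_dim hf).trans hm))

theorem rootBasis_apply (hf : f.Monic) (hm : f.natDegree = m) (x : Fin m) :
    rootBasis hf hm x = AdjoinRoot.root f ^ (x : ℕ) := by
  simp [rootBasis]

/-- Row z holds the coordinates of α ^ (z + 1); for the last row this is the equation f(α) = 0. -/
theorem sum_companionMatrix (hf : f.Monic) (hm : f.natDegree = m) (z : Fin m) :
    ∑ u : Fin m, companionMatrix m f z u • AdjoinRoot.root f ^ (u : ℕ) =
      AdjoinRoot.root f ^ ((z : ℕ) + 1) := by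
  by_cases hz : (z : ℕ) + 1 = m
  · simp only [companionMatrix, Matrix.of_apply, if_pos hz]
    have h0 : Polynomial.aeval (AdjoinRoot.root f) f = 0 := by simp
    have h1 := hf.as_sum
    rw [hm] at h1
    have h2 := congrArg (Polynomial.aeval (AdjoinRoot.root f)) h1
    rw [h0, map_add, map_sum] at h2
    rw [Fin.sum_univ_eq_sum_range (fun u => -f.coeff u • AdjoinRoot.root f ^ u), hz,
      eq_comm, ← sub_eq_zero, h2, sub_eq_add_neg, ← Finset.sum_neg_distrib]
    simp [Algebra.smul_def]
  · simp only [companionMatrix, Matrix.of_apply, if_neg hz]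
    rw [Finset.sum_eq_single ⟨z + 1, by omega⟩]
    · simp
    · intro u _ hu
      rw [if_neg (fun h => hu (Fin.ext h)), zero_smul]
    · simp

theorem sum_companionMatrix_pow (hf : f.Monic) (hm : f.natDegree = m) (j : ℕ) (z : Fin m) :
    ∑ u : Fin m, (companionMatrix m f ^ j) z u • AdjoinRoot.root f ^ (u : ℕ) =
      AdjoinRoot.root f ^ ((z : ℕ) + j) := by
  induction j with
  | zero => simp [Matrix.one_apply]
  | succ j ih =>
    simp only [pow_succ (companionMatrix m f) j, Matrix.mul_apply, Finset.sum_smul]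
    rw [Finset.sum_comm]
    simp only [mul_smul, ← Finset.smul_sum, sum_companionMatrix hf hm]
    rw [← add_assoc, pow_succ, ← ih, Finset.sum_mul]
    simp [pow_succ]

theorem blockEmb_vecMul_blockDiag [Fact (Irreducible f)] (hf : f.Monic)
    (hm : f.natDegree = m) {o : ℕ} (hn : o + m = n) (j : ℕ) (γ : AdjoinRoot f) :
    Matrix.vecMul (blockEmb (rootBasis hf hm) n o γ) (blockDiag n o (companionMatrix m f ^ j)) =
      blockEmb (rootBasis hf hm) n o (γ * AdjoinRoot.root f ^ j) := by
  have : Matrix.vecMulLinear (blockDiag n o (companionMatrix m f ^ j)) ∘ₗ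
      blockEmb (rootBasis hf hm) n o =
      blockEmb (rootBasis hf hm) n o ∘ₗ LinearMap.mulRight F (AdjoinRoot.root f ^ j) := by
    refine (rootBasis hf hm).ext fun z => ?_
    have hz : o + (z : ℕ) < n := by omega
    rw [LinearMap.comp_apply, LinearMap.comp_apply, blockEmb_basis, Matrix.vecMulLinear_apply,
      unitVec_vecMul _ hz, blockDiag_row_of_ge, LinearMap.mulRight_apply, rootBasis_apply,
      ← pow_add, ← sum_companionMatrix_pow hf hm, map_sum]
    refine Finset.sum_congr rfl fun u _ => ?_
    rw [map_smul, ← rootBasis_apply hf hm, blockEmb_basis]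
  exact LinearMap.congr_fun this γ

theorem genRow_vecMul_blockDiag [Fact (Irreducible f)] (hf : f.Monic)
    (hm : f.natDegree = m) {a k : ℕ} (hn : a + k + m = n) (hkm : k ≤ m) (j : ℕ)
    (β γ : AdjoinRoot f) {x : ℕ} :
    Matrix.vecMul (genRow (rootBasis hf hm) n a k (AdjoinRoot.root f) β γ x)
        (blockDiag n (a + k) (companionMatrix m f ^ j)) =
      genRow (rootBasis hf hm) n a k (AdjoinRoot.root f) (β * AdjoinRoot.root f ^ j)
        (γ * AdjoinRoot.root f ^ j) x := by
  have hunit : ∀ y < a + k, Matrix.vecMul (unitVec F n y)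
      (blockDiag n (a + k) (companionMatrix m f ^ j)) = unitVec F n y := fun y hy => by
    rw [unitVec_vecMul _ (by omega), blockDiag_row_of_lt _ _ hy]
  by_cases hxk : x < k
  · rw [genRow_of_lt hxk, genRow_of_lt hxk, Matrix.add_vecMul, hunit _ (by omega),
      blockEmb_vecMul_blockDiag hf hm hn, mul_right_comm]
  by_cases hxm : x < m
  · rw [genRow_of_mid (by omega) hxm, genRow_of_mid (by omega) hxm,
      blockEmb_vecMul_blockDiag hf hm hn, mul_right_comm]
  by_cases hxa : x < m + a
  · rw [genRow_of_unit hkm (by omega) hxa, genRow_of_unit hkm (by omega) hxa, hunit _ (by omega)]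
  · rw [genRow_of_last hkm (by omega), genRow_of_last hkm (by omega),
      blockEmb_vecMul_blockDiag hf hm hn, mul_right_comm]

variable {K : Type*} [Field K] [Algebra F K] {k h i a : ℕ} {α : K}

theorem matA_eq {b : Module.Basis (Fin m) F K} (hb : ∀ x, b x = α ^ (x : ℕ)) (hkm : k ≤ m)
    (hn : a + k + m = 4 * k + h) (hk : 0 < k) (hm : i * k + h = m) (ha : (4 - i - 1) * k = a)
    (ha' : (4 - i) * k = a + k) :
    matA F 4 k h i = rowsMatrix (genRow b (4 * k + h) a k α 1 1) := by
  ext x y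
  simp only [matA, rowsMatrix, Matrix.of_apply, hm, ha, ha']
  rw [show (4 - 1) * k + h = m + a by omega]
  have hx := x.2
  by_cases hxk : (x : ℕ) < k
  · rw [if_pos hxk, genRow_of_lt hxk, one_mul, blockEmb_pow hb _ _ (by omega), Pi.add_apply]
    simp only [unitVec]
    -- The columns a + x and a + k + x differ, so the two ones never add up in one entry.
    split_ifs <;> first | omega | simp
  by_cases hxm : (x : ℕ) < m
  · rw [if_neg hxk, if_pos hxm, genRow_of_mid (by omega) hxm, one_mul, blockEmb_pow hb _ _ hxm]
    rfl
  by_cases hxa : (x : ℕ) < m + a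
  · rw [if_neg hxk, if_neg hxm, if_pos hxa, genRow_of_unit hkm (by omega) hxa]
    rfl
  · rw [if_neg hxk, if_neg hxm, if_neg hxa, genRow_of_last hkm (by omega), one_mul,
      blockEmb_pow hb _ _ (by omega)]
    rfl

theorem matB_eq {b : Module.Basis (Fin m) F K} (hb : ∀ x, b x = α ^ (x : ℕ)) (hkm : k ≤ m)
    (hn : a + k + m = 4 * k + h) (hm : i * k + h = m) (ha : (4 - i - 1) * k = a)
    (ha' : (4 - i) * k = a + k) :
    matB F 4 k h i = rowsMatrix (genRow b (4 * k + h) a k α 0 1) := by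
  ext x y
  simp only [matB, rowsMatrix, Matrix.of_apply, hm, ha, ha']
  rw [show (4 - 1) * k + h = m + a by omega]
  have hx := x.2
  by_cases hxa : (x : ℕ) < m + a
  · rw [genRow_zero_one hb hkm hxa, unitVec]
    split_ifs <;> rfl
  · rw [if_neg (by omega), if_neg (by omega), if_neg hxa, genRow_of_last hkm (by omega), one_mul,
      blockEmb_pow hb _ _ (by omega)]
    rfl

theorem matM_eq : matM F n = rowsMatrix (lastRow F n) := by
  ext x y
  simp only [matM, rowsMatrix, Matrix.of_apply, lastRow, unitVec]
  exact if_congr (by omega) rfl rfl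

theorem rowsMatrix_genRow_mul [Fact (Irreducible f)] (hf : f.Monic) (hm : f.natDegree = m)
    (hn : a + k + m = n) (hkm : k ≤ m) (j : ℕ) :
    rowsMatrix (genRow (rootBasis hf hm) n a k (AdjoinRoot.root f) 1 1) *
        blockDiag n (a + k) (companionMatrix m f ^ j) =
      rowsMatrix (genRow (rootBasis hf hm) n a k (AdjoinRoot.root f) (AdjoinRoot.root f ^ j)
        (AdjoinRoot.root f ^ j)) := by
  funext x
  rw [Matrix.mul_apply_eq_vecMul]
  have := genRow_vecMul_blockDiag hf hm hn hkm j 1 1 (x := x)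
  rwa [one_mul] at this

end Matrices

/-! ### Primitive elements -/

section Primitive

variable {F : Type*} [Field F] [Fintype F] {f : F[X]} {m : ℕ}

theorem natCard_adjoinRoot (hf : f.Monic) (hm : f.natDegree = m) :
    Nat.card (AdjoinRoot f) = Fintype.card F ^ m := by
  rw [Nat.card_congr (rootBasis hf hm).equivFun.toEquiv, Nat.card_fun, Nat.card_eq_fintype_card,
    Nat.card_eq_fintype_card, Fintype.card_fin]

theorem finite_adjoinRoot (hf : f.Monic) : Finite (AdjoinRoot f) :=
  Finite.of_equiv _ (rootBasis hf rfl).equivFun.toEquiv.symm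

theorem IsPrimitivePoly.root_ne_zero [Fact (Irreducible f)] (hf : IsPrimitivePoly f m) :
    AdjoinRoot.root f ≠ 0 := by
  intro h0
  have h1 := hf.2.2.2
  have hm : m ≠ 0 := by
    rw [← hf.2.2.1]
    exact hf.2.1.natDegree_pos.ne'
  have h2 : 1 < Fintype.card F ^ m := Nat.one_lt_pow hm Fintype.one_lt_card
  rw [h0] at h1
  have h3 : orderOf (0 : AdjoinRoot f) = 0 := by simp
  omega

/-- The order of the root equals the order of the unit group, so the root generates it. -/
theorem IsPrimitivePoly.exists_pow_eq [Fact (Irreducible f)] (hf : IsPrimitivePoly f m)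
    {β : AdjoinRoot f} (hβ : β ≠ 0) : ∃ j : ℕ, AdjoinRoot.root f ^ j = β := by
  have := finite_adjoinRoot hf.1
  set u := Units.mk0 _ hf.root_ne_zero with hu
  have h1 : orderOf u = Nat.card (AdjoinRoot f)ˣ := by
    rw [← orderOf_units, Nat.card_units, natCard_adjoinRoot hf.1 hf.2.2.1, ← hf.2.2.2]
    rfl
  have h2 : Subgroup.zpowers u = ⊤ := by
    rw [← Subgroup.card_eq_iff_eq_top, Nat.card_zpowers, h1]
  obtain ⟨j, hj⟩ := mem_powers_iff_mem_zpowers.2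
    (h2 ▸ Subgroup.mem_top (Units.mk0 β hβ) : Units.mk0 β hβ ∈ Subgroup.zpowers u)
  exact ⟨j, by simpa [hu] using congrArg Units.val hj⟩

end Primitive

/-! ### The family of all generators -/

section Family

variable {F : Type*} [Field F] {k h : ℕ}

/-- Makes the block widths linear in k, so that linear arithmetic can compare them. -/
theorem block_widths (k : ℕ) (j : Fin 3) :
    ((j : ℕ) = 0 ∧ (2 - (j : ℕ)) * k = 2 * k ∧ ((j : ℕ) + 1) * k = k) ∨
    ((j : ℕ) = 1 ∧ (2 - (j : ℕ)) * k = k ∧ ((j : ℕ) + 1) * k = 2 * k) ∨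
    ((j : ℕ) = 2 ∧ (2 - (j : ℕ)) * k = 0 ∧ ((j : ℕ) + 1) * k = 3 * k) := by
  obtain ⟨j, hj⟩ := j
  interval_cases j <;> simp

/-- `B_1` and `B_3` are as close as the minimum distance. -/
theorem le_finrank_inf_unit {K K' : Type*} [Field K] [Algebra F K] [Field K'] [Algebra F K']
    {m m' n a a' : ℕ} {b : Module.Basis (Fin m) F K} {b' : Module.Basis (Fin m') F K'} {α : K}
    {α' : K'} (hb : ∀ x, b x = α ^ (x : ℕ)) (hb' : ∀ x, b' x = α' ^ (x : ℕ)) (ha : a = 2 * k)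
    (ha' : a' = 0) (hm : m = k + h) (hm' : m' = 3 * k + h) (hn : n = 4 * k + h)
    (hhk : h < k) :
    (∀ t, k ≤ t → t ≤ k + h →
      t - k ≤ Module.finrank F ↥(prefixSpan F (genRow b n a k α 0 1) t ⊓
        prefixSpan F (genRow b' n a' k α' 0 1) t)) ∧
    2 * k ≤ Module.finrank F ↥(prefixSpan F (genRow b n a k α 0 1) (2 * k + h) ⊓
      prefixSpan F (genRow b' n a' k α' 0 1) (2 * k + h)) := by
  subst ha'
  have key : ∀ x < 2 * k + h, ∀ y, y = (if x < k then a + x else if x < m then a + k + x else x - m)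
      → genRow b n a k α 0 1 x = unitVec F n y := by
    rintro x hx y rfl
    exact genRow_zero_one hb (by omega) (by omega)
  have key' : ∀ x < 2 * k + h, ∀ y, y = (if x < k then x else k + x)
      → genRow b' n 0 k α' 0 1 x = unitVec F n y := by
    rintro x hx y rfl
    rw [genRow_zero_one hb' (by omega) (by omega)]
    congr 1
    split_ifs <;> omega
  constructor
  · intro t hkt ht
    -- The unit vector in column 2k + z is row z of B_1 and row k + z of B_3.
    refine le_finrank_of_unitVec_mem (n := n) (g := fun z : Fin (t - k) => 2 * k + z)
      (fun x y hxy => Fin.ext (by simpa using hxy)) (fun z => by omega) fun z => ⟨?_, ?_⟩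
    · rw [← key z (by omega) _ (by split_ifs <;> omega)]
      exact apply_mem_prefixSpan (by omega)
    · rw [← key' (k + z) (by omega) _ (by split_ifs <;> omega)]
      exact apply_mem_prefixSpan (by omega)
  -- The common columns are 0, …, k - 1 and 2k, …, 3k - 1.
  · refine le_finrank_of_unitVec_mem (n := n)
      (g := fun z : Fin (2 * k) => if (z : ℕ) < k then z else k + z)
      (fun x y hxy => Fin.ext ?_) (fun z => by split_ifs <;> omega) fun z => ?_
    · dsimp only at hxy
      split_ifs at hxy <;> omega
    by_cases hz : (z : ℕ) < k
    · rw [if_pos hz]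
      constructor
      · rw [← key (m + z) (by omega) _ (by split_ifs <;> omega)]
        exact apply_mem_prefixSpan (by omega)
      · rw [← key' z (by omega) _ (by split_ifs; omega)]
        exact apply_mem_prefixSpan (by omega)
    · rw [if_neg hz]
      constructor
      · rw [← key (z - k) (by omega) _ (by split_ifs <;> omega)]
        exact apply_mem_prefixSpan (by omega)
      · rw [← key' z (by omega) _ (by split_ifs; omega)]
        exact apply_mem_prefixSpan (by omega)

section Indexed

variable {K : Fin 3 → Type*} [∀ j, Field (K j)] [∀ j, Algebra F (K j)]

open Classical in
/-- The parameter `γ` that belongs to the parameter `β` of a generator. -/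
def genScale {L : Type*} [Field L] (β : L) : L := if β = 0 then 1 else β

theorem genScale_zero {L : Type*} [Field L] : genScale (0 : L) = 1 := if_pos rfl

theorem genScale_of_ne_zero {L : Type*} [Field L] {β : L} (hβ : β ≠ 0) : genScale β = β :=
  if_neg hβ

theorem isGenPair_genScale {L : Type*} [Field L] (β : L) : IsGenPair β (genScale β) := by
  by_cases hβ : β = 0
  · exact Or.inr ⟨hβ, hβ ▸ genScale_zero⟩
  · rw [genScale_of_ne_zero hβ]
    exact Or.inl ⟨rfl, hβ⟩

/-- The rows of all generators: `none` stands for `M`, the pair of `j` and `0` for `B_{j + 1}` and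
the pair of `j` and `α ^ e` for `A_{j + 1} * g`, where `g` is the power with exponent `e` of the
generator of the cyclic group. -/
def genSeq (b : ∀ j : Fin 3, Module.Basis (Fin ((j + 1) * k + h)) F (K j)) (α : ∀ j, K j) :
    Option (Σ j, K j) → ℕ → Fin (4 * k + h) → F
  | none => lastRow F _
  | some ⟨j, β⟩ => genRow (b j) _ ((2 - j) * k) k (α j) β (genScale β)

variable {b : ∀ j : Fin 3, Module.Basis (Fin ((j + 1) * k + h)) F (K j)} {α : ∀ j, K j}

theorem finrank_prefixSpan_genSeq (hb : ∀ j x, b j x = α j ^ (x : ℕ)) (p : Option (Σ j, K j))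
    {t : ℕ} (ht : t ≤ 4 * k + h) : Module.finrank F ↥(prefixSpan F (genSeq b α p) t) = t := by
  rcases p with - | ⟨j, β⟩
  · exact finrank_prefixSpan_lastRow ht
  · have := block_widths k j
    exact finrank_prefixSpan_genRow (hb j) (by omega) (by omega) (isGenPair_genScale β).ne_zero ht

theorem farApart_genSeq_lt (hb : ∀ j x, b j x = α j ^ (x : ℕ)) (hhk : h < k) {j j' : Fin 3}
    (hj : j < j') (β : K j) (β' : K j') :
    FarApart k h (genSeq b α (some ⟨j, β⟩)) (genSeq b α (some ⟨j', β'⟩)) := by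
  have h1 := block_widths k j
  have h2 := block_widths k j'
  have h3 : (j : ℕ) < j' := hj
  exact farApart_lt (hb j) (hb j') (by omega) (by omega) (by omega) (by omega) hhk (by omega)
    (isGenPair_genScale β) (isGenPair_genScale β') (by omega)

theorem farApart_genSeq_none (hhk : h < k) (p : Σ j, K j) :
    FarApart k h (genSeq b α none) (genSeq b α (some p)) := by
  obtain ⟨j, β⟩ := p
  have h1 := block_widths k j
  exact farApart_lastRow (by omega) (by omega) (by omega) hhk (by omega)

theorem farApart_genSeq (hb : ∀ j x, b j x = α j ^ (x : ℕ)) (hhk : h < k)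
    {p p' : Option (Σ j, K j)} (hp : p ≠ p') :
    FarApart k h (genSeq b α p) (genSeq b α p') := by
  rcases p with - | ⟨j, β⟩
  · rcases p' with - | p'
    · exact absurd rfl hp
    · exact farApart_genSeq_none hhk p'
  rcases p' with - | ⟨j', β'⟩
  · exact (farApart_genSeq_none hhk _).symm
  rcases lt_trichotomy j j' with hj | rfl | hj
  · exact farApart_genSeq_lt hb hhk hj β β'
  · have h1 := block_widths k j
    refine farApart_same (hb j) (by omega) (by omega) (by omega) hhk (isGenPair_genScale β)
      (isGenPair_genScale β') ?_
    rintro rfl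
    exact hp rfl
  · exact (farApart_genSeq_lt hb hhk hj β' β).symm

theorem genSeq_zero (j : Fin 3) :
    genSeq b α (some ⟨j, 0⟩) = genRow (b j) (4 * k + h) ((2 - j) * k) k (α j) 0 1 := by
  rw [genSeq, genScale_zero]

theorem le_finrank_inf_genSeq (hb : ∀ j x, b j x = α j ^ (x : ℕ)) (hhk : h < k) :
    (∀ t, k ≤ t → t ≤ k + h →
      t - k ≤ Module.finrank F ↥(prefixSpan F (genSeq b α (some ⟨0, 0⟩)) t ⊓
        prefixSpan F (genSeq b α (some ⟨2, 0⟩)) t)) ∧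
    2 * k ≤ Module.finrank F ↥(prefixSpan F (genSeq b α (some ⟨0, 0⟩)) (2 * k + h) ⊓
      prefixSpan F (genSeq b α (some ⟨2, 0⟩)) (2 * k + h)) := by
  rw [genSeq_zero, genSeq_zero]
  exact le_finrank_inf_unit (hb 0) (hb 2) (by simp) (by simp) (by simp) (by simp) rfl hhk

end Indexed

variable [Fintype F] {f : ℕ → F[X]}

theorem generators_eq_range (hk : 0 < k) [∀ j : Fin 3, Fact (Irreducible (f (j + 1)))]
    (hf : ∀ j : Fin 3, IsPrimitivePoly (f (j + 1)) ((j + 1) * k + h)) :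
    generators 4 k h f = Set.range fun p => rowsMatrix
      (genSeq (k := k) (h := h) (fun j => rootBasis (hf j).1 (hf j).2.2.1)
        (fun j => AdjoinRoot.root (f (j + 1))) p) := by
  have hA : ∀ j : Fin 3, ∀ e : ℕ, matA F 4 k h (j + 1) *
      blockDiag (4 * k + h) ((4 - (j + 1)) * k)
        (companionMatrix ((j + 1) * k + h) (f (j + 1)) ^ e) =
      rowsMatrix (genSeq (k := k) (h := h) (fun j => rootBasis (hf j).1 (hf j).2.2.1)
        (fun j => AdjoinRoot.root (f (j + 1))) (some ⟨j, AdjoinRoot.root (f (j + 1)) ^ e⟩)) := by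
    intro j e
    have h1 := block_widths k j
    have h2 : (4 - ((j : ℕ) + 1)) * k = (2 - (j : ℕ)) * k + k := by
      rw [show 4 - ((j : ℕ) + 1) = (2 - (j : ℕ)) + 1 by omega]
      ring
    have h3 : (4 - ((j : ℕ) + 1) - 1) * k = (2 - (j : ℕ)) * k := by
      rw [show 4 - ((j : ℕ) + 1) - 1 = 2 - (j : ℕ) by omega]
    rw [matA_eq (rootBasis_apply (hf j).1 (hf j).2.2.1) (by omega) (by omega) hk rfl h3 h2, h2,
      rowsMatrix_genRow_mul _ _ (by omega) (by omega), genSeq,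
      genScale_of_ne_zero (pow_ne_zero _ (hf j).root_ne_zero)]
  have hB : ∀ j : Fin 3, matB F 4 k h (j + 1) =
      rowsMatrix (genSeq (k := k) (h := h) (fun j => rootBasis (hf j).1 (hf j).2.2.1)
        (fun j => AdjoinRoot.root (f (j + 1))) (some ⟨j, 0⟩)) := by
    intro j
    have h1 := block_widths k j
    have h2 : (4 - ((j : ℕ) + 1)) * k = (2 - (j : ℕ)) * k + k := by
      rw [show 4 - ((j : ℕ) + 1) = (2 - (j : ℕ)) + 1 by omega]
      ring
    have h3 : (4 - ((j : ℕ) + 1) - 1) * k = (2 - (j : ℕ)) * k := by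
      rw [show 4 - ((j : ℕ) + 1) - 1 = 2 - (j : ℕ) by omega]
    rw [matB_eq (rootBasis_apply (hf j).1 (hf j).2.2.1) (by omega) (by omega) rfl h3 h2, genSeq,
      genScale_zero]
  ext W
  constructor
  · rintro (⟨i, hi, g, ⟨e, rfl⟩, rfl⟩ | ⟨i, hi, rfl⟩ | rfl)
    · obtain ⟨h1, h2⟩ := Finset.mem_Icc.1 hi
      obtain ⟨i, rfl⟩ := Nat.exists_eq_add_of_le' h1
      exact ⟨_, (hA ⟨i, by omega⟩ e).symm⟩
    · obtain ⟨h1, h2⟩ := Finset.mem_Icc.1 hi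
      obtain ⟨i, rfl⟩ := Nat.exists_eq_add_of_le' h1
      exact ⟨_, (hB ⟨i, by omega⟩).symm⟩
    · exact ⟨none, matM_eq.symm⟩
  · rintro ⟨p, rfl⟩
    rcases p with - | ⟨j, β⟩
    · exact Or.inr (Or.inr matM_eq.symm)
    have hj : (j : ℕ) + 1 ∈ Finset.Icc 1 (4 - 1) := Finset.mem_Icc.2 (by omega)
    by_cases hβ : β = 0
    · subst hβ
      exact Or.inr (Or.inl ⟨_, hj, (hB j).symm⟩)
    · obtain ⟨e, rfl⟩ := (hf j).exists_pow_eq hβ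
      exact Or.inl ⟨_, hj, _, ⟨e, rfl⟩, (hA j e).symm⟩

theorem natCard_index (hf : ∀ j : Fin 3, IsPrimitivePoly (f (j + 1)) ((j + 1) * k + h)) :
    Nat.card (Option (Σ j : Fin 3, AdjoinRoot (f (j + 1)))) =
      (∑ i ∈ Finset.Icc 1 3, Fintype.card F ^ (i * k + h)) + 1 := by
  have := fun j => finite_adjoinRoot (hf j).1
  rw [Finite.card_option, Nat.card_sigma, Fin.sum_univ_three,
    natCard_adjoinRoot (hf 0).1 (hf 0).2.2.1, natCard_adjoinRoot (hf 1).1 (hf 1).2.2.1,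
    natCard_adjoinRoot (hf 2).1 (hf 2).2.2.1,
    show Finset.Icc 1 3 = {1, 2, 3} from rfl]
  simp [add_assoc]

end Family

/-! ### Distances and cardinalities -/

section Distance

variable {F : Type*} [Field F]

theorem subspaceDist_eq {n t : ℕ} {U V : Submodule F (Fin n → F)} (hU : Module.finrank F U = t)
    (hV : Module.finrank F V = t) :
    subspaceDist U V = 2 * t - 2 * Module.finrank F ↥(U ⊓ V) := by
  have := Submodule.finrank_sup_add_finrank_inf_eq U V
  rw [subspaceDist]
  omega

theorem subspaceDist_self {n : ℕ} (U : Submodule F (Fin n → F)) : subspaceDist U U = 0 := by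
  rw [subspaceDist, sup_idem, inf_idem, Nat.sub_self]

/-- The contribution of the dimension `t` to the minimum distance. -/
def minDistTerm (k h t : ℕ) : ℕ :=
  (if t ≤ k then 2 * t else 0) + (if 4 * k + h - k ≤ t then 2 * (4 * k + h - t) else 0) +
    (if k + 1 ≤ t ∧ t ≤ k + h then 2 * k else 0) + (if t = 2 * k + h then 2 * h else 0)

/-- The dimensions that the theorem considers. -/
def AdmissibleDim (k h t : ℕ) : Prop :=
  (1 ≤ t ∧ t ≤ k + h) ∨ t = 2 * k + h ∨ (3 * k + h ≤ t ∧ t ≤ 4 * k + h - 1)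

variable {k h t : ℕ} {w w' : ℕ → Fin (4 * k + h) → F}

/-- The only admissible dimension that contributes nothing is 2k for h = 0, where B_1 and B_3 have
the same component. -/
theorem minDistTerm_pos (hhk : h < k) (ht : AdmissibleDim k h t) (hth : t ≠ 2 * k + h ∨ 1 ≤ h) :
    0 < minDistTerm k h t := by
  unfold minDistTerm
  rcases ht with ht | ht | ht <;> split_ifs <;> omega

theorem minDistTerm_le (hhk : h < k) (ht : AdmissibleDim k h t) (hw : FarApart k h w w')
    (hd : ∀ t ≤ 4 * k + h, Module.finrank F ↥(prefixSpan F w t) = t)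
    (hd' : ∀ t ≤ 4 * k + h, Module.finrank F ↥(prefixSpan F w' t) = t) :
    minDistTerm k h t ≤ subspaceDist (prefixSpan F w t) (prefixSpan F w' t) := by
  have htn : t ≤ 4 * k + h := by unfold AdmissibleDim at ht; omega
  rw [subspaceDist_eq (hd t htn) (hd' t htn)]
  unfold minDistTerm
  rcases ht with ht | ht | ht
  · have := hw.finrank_inf_le t ht.2
    split_ifs <;> omega
  · have := hw.finrank_inf_mid_le
    rw [← ht] at this
    split_ifs <;> omega
  · have h1 : prefixSpan F w t ⊔ prefixSpan F w' t = ⊤ :=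
      top_le_iff.1 (hw.sup_eq_top ▸
        sup_le_sup (prefixSpan_mono w ht.1) (prefixSpan_mono w' ht.1))
    have h2 := Submodule.finrank_sup_add_finrank_inf_eq (prefixSpan F w t) (prefixSpan F w' t)
    rw [h1, finrank_top, Module.finrank_fin_fun, hd t htn, hd' t htn] at h2
    split_ifs <;> omega

/-- Below k and from 3k + h on, no closeness is needed: two subspaces of dimension t have distance
at most 2t and at most 2(n - t). -/
theorem le_minDistTerm (hhk : h < k) (ht : AdmissibleDim k h t)
    (hd : ∀ t ≤ 4 * k + h, Module.finrank F ↥(prefixSpan F w t) = t)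
    (hd' : ∀ t ≤ 4 * k + h, Module.finrank F ↥(prefixSpan F w' t) = t)
    (hlow : k ≤ t → t ≤ k + h →
      t - k ≤ Module.finrank F ↥(prefixSpan F w t ⊓ prefixSpan F w' t))
    (hmid : 2 * k ≤
      Module.finrank F ↥(prefixSpan F w (2 * k + h) ⊓ prefixSpan F w' (2 * k + h))) :
    subspaceDist (prefixSpan F w t) (prefixSpan F w' t) ≤ minDistTerm k h t := by
  have htn : t ≤ 4 * k + h := by unfold AdmissibleDim at ht; omega
  rw [subspaceDist_eq (hd t htn) (hd' t htn)]
  unfold minDistTerm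
  rcases ht with ht | ht | ht
  · by_cases hkt : k ≤ t
    · have := hlow hkt ht.2
      split_ifs <;> omega
    · split_ifs <;> omega
  · rw [← ht] at hmid
    split_ifs <;> omega
  · have h1 := Submodule.finrank_le (prefixSpan F w t ⊔ prefixSpan F w' t)
    have h2 := Submodule.finrank_sup_add_finrank_inf_eq (prefixSpan F w t) (prefixSpan F w' t)
    rw [Module.finrank_fin_fun] at h1
    rw [hd t htn, hd' t htn] at h2
    split_ifs <;> omega

end Distance

/-! ### Flag codes of families of generators that are far apart -/

section Codes

variable {F : Type*} [Field F] {k h r : ℕ} {f : ℕ → F[X]} {ι : Type*}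
  {w : ι → ℕ → Fin (4 * k + h) → F} {t : Fin r → ℕ}

theorem AdmissibleDim.le {s : ℕ} (hk : 0 < k) (hs : AdmissibleDim k h s) :
    1 ≤ s ∧ s ≤ 4 * k + h - 1 := by
  unfold AdmissibleDim at hs
  omega

theorem flagCode_eq_range (hgen : generators 4 k h f = Set.range fun p => rowsMatrix (w p))
    (ht : ∀ i, t i ≤ 4 * k + h - 1) :
    flagCode 4 k h f t = Set.range fun p i => prefixSpan F (w p) (t i) := by
  ext 𝓕
  rw [flagCode, hgen]
  constructor
  · rintro ⟨_, ⟨p, rfl⟩, rfl⟩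
    exact ⟨p, funext fun i => (initialRowSpace_rowsMatrix (w p) (ht i)).symm⟩
  · rintro ⟨p, rfl⟩
    exact ⟨_, ⟨p, rfl⟩, funext fun i => (initialRowSpace_rowsMatrix (w p) (ht i)).symm⟩

theorem subspaceCode_eq_range
    (hgen : generators 4 k h f = Set.range fun p => rowsMatrix (w p)) :
    subspaceCode 4 k h f = Set.range fun p => prefixSpan F (w p) (4 * k + h - 1) := by
  rw [subspaceCode, hgen, ← Set.range_comp]
  exact congrArg Set.range (funext fun p => rowSpace_rowsMatrix (w p))

theorem ncard_range_of_injective {β : Type*} {g : ι → β} (hg : Function.Injective g) :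
    (Set.range g).ncard = Nat.card ι := by
  rw [← Set.image_univ, Set.ncard_image_of_injective _ hg, Set.ncard_univ]

theorem injective_prefixSpan (hhk : h < k) (hfar : ∀ p p', p ≠ p' → FarApart k h (w p) (w p'))
    (hd : ∀ p, ∀ s ≤ 4 * k + h, Module.finrank F ↥(prefixSpan F (w p) s) = s) {s : ℕ}
    (hs : AdmissibleDim k h s) (hsh : s ≠ 2 * k + h ∨ 1 ≤ h) :
    Function.Injective fun p => prefixSpan F (w p) s := by
  intro p p' hpp
  by_contra hne
  have h1 := minDistTerm_le hhk hs (hfar p p' hne) (hd p) (hd p')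
  have h2 := minDistTerm_pos hhk hs hsh
  rw [show prefixSpan F (w p) s = prefixSpan F (w p') s from hpp, subspaceDist_self] at h1
  omega

theorem flagCode_properties (hhk : h < k)
    (hgen : generators 4 k h f = Set.range fun p => rowsMatrix (w p))
    (hfar : ∀ p p', p ≠ p' → FarApart k h (w p) (w p'))
    (hd : ∀ p, ∀ s ≤ 4 * k + h, Module.finrank F ↥(prefixSpan F (w p) s) = s) {p₁ p₂ : ι}
    (hp : p₁ ≠ p₂)
    (hclose : ∀ s, AdmissibleDim k h s →
      subspaceDist (prefixSpan F (w p₁) s) (prefixSpan F (w p₂) s) ≤ minDistTerm k h s)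
    (ht : StrictMono t) (hadm : ∀ i, AdmissibleDim k h (t i))
    (hex : ∃ i, t i ≠ 2 * k + h ∨ 1 ≤ h) :
    IsFlagCode t (flagCode 4 k h f t) ∧
      (∀ i, t i ≠ 2 * k + h ∨ 1 ≤ h →
        (projectedCode (flagCode 4 k h f t) i).ncard = (flagCode 4 k h f t).ncard) ∧
      (flagCode 4 k h f t).ncard = (fullFlagCode 4 k h f).ncard ∧
      (fullFlagCode 4 k h f).ncard = (subspaceCode 4 k h f).ncard ∧
      (subspaceCode 4 k h f).ncard = Nat.card ι ∧
      IsMinFlagDist (flagCode 4 k h f t) (∑ i, minDistTerm k h (t i)) := by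
  have hk : 0 < k := by omega
  have htn : ∀ i, t i ≤ 4 * k + h - 1 := fun i => ((hadm i).le hk).2
  have hinj : ∀ i, t i ≠ 2 * k + h ∨ 1 ≤ h →
      Function.Injective fun p => prefixSpan F (w p) (t i) := fun i hi =>
    injective_prefixSpan hhk hfar hd (hadm i) hi
  have hlast : Function.Injective fun p => prefixSpan F (w p) (4 * k + h - 1) :=
    injective_prefixSpan hhk hfar hd (Or.inr (Or.inr ⟨by omega, le_rfl⟩)) (Or.inl (by omega))
  have hflag : Function.Injective fun p (i : Fin r) => prefixSpan F (w p) (t i) := by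
    obtain ⟨i, hi⟩ := hex
    exact fun p p' hpp => hinj i hi (congrFun hpp i)
  have hfull : (fullFlagCode 4 k h f).ncard = Nat.card ι := by
    rw [fullFlagCode, flagCode_eq_range hgen fun i => by omega, ncard_range_of_injective]
    intro p p' hpp
    -- Positions of the full flag start at 0, so this one carries the component of dimension n - 1.
    have := congrFun hpp ⟨4 * k + h - 2, by omega⟩
    simp only [show 4 * k + h - 2 + 1 = 4 * k + h - 1 by omega] at this
    exact hlast this
  have hcard : (flagCode 4 k h f t).ncard = Nat.card ι := by
    rw [flagCode_eq_range hgen htn, ncard_range_of_injective hflag]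
  have hsub : (subspaceCode 4 k h f).ncard = Nat.card ι := by
    rw [subspaceCode_eq_range hgen, ncard_range_of_injective hlast]
  refine ⟨⟨?_, ?_⟩, fun i hi => ?_, hcard.trans hfull.symm, hfull.trans hsub.symm, hsub, ?_, ?_⟩
  · rw [flagCode_eq_range hgen htn]
    exact ⟨_, p₁, rfl⟩
  · rw [flagCode_eq_range hgen htn]
    rintro _ ⟨p, rfl⟩
    have hdim : ∀ i, Module.finrank F ↥(prefixSpan F (w p) (t i)) = t i := fun i =>
      hd p _ ((htn i).trans (Nat.sub_le _ _))
    refine ⟨fun i i' hii => lt_of_le_of_ne (prefixSpan_mono (w p) (ht hii).le) fun heq => ?_,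
      fun i => bot_lt_iff_ne_bot.2 fun heq => ?_, fun i => lt_top_iff_ne_top.2 fun heq => ?_, hdim⟩
    · have h1 := hdim i
      rw [show prefixSpan F (w p) (t i) = prefixSpan F (w p) (t i') from heq, hdim i'] at h1
      exact (ht hii).ne' h1
    · have h1 := hdim i
      have h2 := (hadm i).le hk
      rw [show prefixSpan F (w p) (t i) = ⊥ from heq, finrank_bot] at h1
      omega
    · have h1 := hdim i
      have h2 := (hadm i).le hk
      rw [show prefixSpan F (w p) (t i) = ⊤ from heq, finrank_top, Module.finrank_fin_fun] at h1
      omega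
  · rw [hcard, projectedCode, flagCode_eq_range hgen htn, ← Set.range_comp]
    exact ncard_range_of_injective (hinj i hi)
  · rw [flagCode_eq_range hgen htn]
    refine ⟨_, ⟨p₁, rfl⟩, _, ⟨p₂, rfl⟩, fun heq => hp (hflag heq), ?_⟩
    exact Finset.sum_congr rfl fun i _ => le_antisymm
      (minDistTerm_le hhk (hadm i) (hfar _ _ hp) (hd _) (hd _)) (hclose _ (hadm i))
  · rw [flagCode_eq_range hgen htn]
    rintro _ ⟨_, ⟨p, rfl⟩, _, ⟨p', rfl⟩, hne, rfl⟩
    refine Finset.sum_le_sum fun i _ => ?_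
    exact minDistTerm_le hhk (hadm i) (hfar _ _ fun heq => hne (by rw [heq])) (hd _) (hd _)

theorem sum_minDistTerm :
    ∑ i, minDistTerm k h (t i) = (∑ i with t i ≤ k, 2 * t i) +
      (∑ i with 4 * k + h - k ≤ t i, 2 * (4 * k + h - t i)) +
      (∑ i with k + 1 ≤ t i ∧ t i ≤ k + h, 2 * k) + (∑ i with t i = 2 * k + h, 2 * h) := by
  simp only [minDistTerm, Finset.sum_add_distrib, Finset.sum_filter]

end Codes

/-- Sizes and minimum distance of the flag code for all admissible types. -/
theorem flagCode_four_properties {F : Type*} [Field F] [Fintype F] {k h : ℕ} (hhk : h < k)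
    {f : ℕ → F[X]} (hf : ∀ i ∈ Finset.Icc 1 3, IsPrimitivePoly (f i) (i * k + h))
    {r : ℕ} {t : Fin r → ℕ} (ht : StrictMono t) (hadm : ∀ i, AdmissibleDim k h (t i))
    (hex : ∃ i, t i ≠ 2 * k + h ∨ 1 ≤ h) :
    IsFlagCode t (flagCode 4 k h f t) ∧
      (∀ i, t i ≠ 2 * k + h ∨ 1 ≤ h →
        (projectedCode (flagCode 4 k h f t) i).ncard = (flagCode 4 k h f t).ncard) ∧
      (flagCode 4 k h f t).ncard = (fullFlagCode 4 k h f).ncard ∧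
      (fullFlagCode 4 k h f).ncard = (subspaceCode 4 k h f).ncard ∧
      (subspaceCode 4 k h f).ncard =
        (∑ i ∈ Finset.Icc 1 3, Fintype.card F ^ (i * k + h)) + 1 ∧
      IsMinFlagDist (flagCode 4 k h f t) (∑ i, minDistTerm k h (t i)) := by
  have hf' : ∀ j : Fin 3, IsPrimitivePoly (f (j + 1)) ((j + 1) * k + h) := fun j =>
    hf _ (Finset.mem_Icc.2 (by omega))
  have : ∀ j : Fin 3, Fact (Irreducible (f (j + 1))) := fun j => ⟨(hf' j).2.1⟩
  have hb : ∀ (j : Fin 3) x, rootBasis (hf' j).1 (hf' j).2.2.1 x =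
      AdjoinRoot.root (f (j + 1)) ^ (x : ℕ) := fun j x => rootBasis_apply _ _ x
  rw [← natCard_index hf']
  have hd := finrank_prefixSpan_genSeq hb
  refine flagCode_properties hhk (generators_eq_range (by omega) hf')
    (fun p p' hp => farApart_genSeq hb hhk hp) (fun p s hs => hd p hs)
    (p₁ := some ⟨0, 0⟩) (p₂ := some ⟨2, 0⟩) (by simp) (fun s hs => ?_) ht hadm hex
  have hclose := le_finrank_inf_genSeq hb hhk
  exact le_minDistTerm hhk hs (fun s hs => hd _ hs) (fun s hs => hd _ hs) (hclose.1 s) hclose.2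

end FlagCodes

end

open FlagCodes in
theorem corollary4p2 {F : Type*} [Field F] [Fintype F] (k h : ℕ) (hhk : h < k)
    (f : ℕ → Polynomial F)
    (hf : ∀ i ∈ Finset.Icc 1 3, IsPrimitivePoly (f i) (i * k + h))
    (r : ℕ) (hr : 1 ≤ r) (t : Fin r → ℕ) (ht : StrictMono t) :
    -- `2k + h` is not an entry of `t`
    ((∀ i, t i ∈ Finset.Icc 1 (k + h) ∪ Finset.Icc (3 * k + h) (4 * k + h - 1)) →
      IsFlagCode t (flagCode 4 k h f t) ∧
      CardinalityConsistent (flagCode 4 k h f t) ∧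
      (flagCode 4 k h f t).ncard = (fullFlagCode 4 k h f).ncard ∧
      (fullFlagCode 4 k h f).ncard = (subspaceCode 4 k h f).ncard ∧
      (subspaceCode 4 k h f).ncard =
        (∑ i ∈ Finset.Icc 1 3, Fintype.card F ^ (i * k + h)) + 1 ∧
      IsMinFlagDist (flagCode 4 k h f t)
        ((∑ i with t i ≤ k, 2 * t i) +
          (∑ i with 4 * k + h - k ≤ t i, 2 * (4 * k + h - t i)) +
          (∑ i with k + 1 ≤ t i ∧ t i ≤ k + h, 2 * k))) ∧
    -- `2k + h` is an entry of `t`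
    ((∃ i, t i = 2 * k + h) →
      (∀ i, t i ∈ Finset.Icc 1 (k + h) ∪ {2 * k + h} ∪
        Finset.Icc (3 * k + h) (4 * k + h - 1)) →
      (1 ≤ h ∨ 2 ≤ r) →
      IsFlagCode t (flagCode 4 k h f t) ∧
      (1 ≤ h → CardinalityConsistent (flagCode 4 k h f t)) ∧
      (∀ i, t i ≠ 2 * k + h →
        (projectedCode (flagCode 4 k h f t) i).ncard = (flagCode 4 k h f t).ncard) ∧
      (flagCode 4 k h f t).ncard = (fullFlagCode 4 k h f).ncard ∧
      (fullFlagCode 4 k h f).ncard = (subspaceCode 4 k h f).ncard ∧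
      (subspaceCode 4 k h f).ncard =
        (∑ i ∈ Finset.Icc 1 3, Fintype.card F ^ (i * k + h)) + 1 ∧
      IsMinFlagDist (flagCode 4 k h f t)
        ((∑ i with t i ≤ k, 2 * t i) +
          (∑ i with 4 * k + h - k ≤ t i, 2 * (4 * k + h - t i)) +
          (∑ i with k + 1 ≤ t i ∧ t i ≤ k + h, 2 * k) + 2 * h)) := by
  classical
  have key := fun hadm hex => flagCode_four_properties hhk hf ht
    (hadm : ∀ i, AdmissibleDim k h (t i))
    (hex : ∃ i, t i ≠ 2 * k + h ∨ 1 ≤ h)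
  constructor
  · intro hadm
    have hne : ∀ i, t i ≠ 2 * k + h := by
      intro i
      have := hadm i
      simp only [Finset.mem_union, Finset.mem_Icc] at this
      omega
    obtain ⟨h1, h2, h3, h4, h5, h6⟩ := key (fun i => by
      have := hadm i
      simp only [Finset.mem_union, Finset.mem_Icc] at this
      unfold AdmissibleDim
      omega) ⟨⟨0, hr⟩, Or.inl (hne _)⟩
    refine ⟨h1, fun i => h2 i (Or.inl (hne i)), h3, h4, h5, ?_⟩
    -- No entry equals 2k + h, so the fourth sum is empty.
    rwa [sum_minDistTerm, Finset.sum_filter (fun i => t i = 2 * k + h),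
      Finset.sum_eq_zero fun i _ => if_neg (hne i), add_zero] at h6
  · rintro ⟨i₀, hi₀⟩ hadm hhr
    obtain ⟨h1, h2, h3, h4, h5, h6⟩ := key (fun i => by
      have := hadm i
      simp only [Finset.mem_union, Finset.mem_Icc, Finset.mem_singleton] at this
      unfold AdmissibleDim
      omega) (by
      rcases hhr with hh | hr2
      · exact ⟨i₀, Or.inr hh⟩
      -- For h = 0, any second entry differs from 2k and keeps the flags apart.
      · have : Nontrivial (Fin r) := Fin.nontrivial_iff_two_le.2 hr2
        obtain ⟨i, hi⟩ := exists_ne i₀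
        exact ⟨i, Or.inl fun heq => hi (ht.injective (heq.trans hi₀.symm))⟩)
    refine ⟨h1, fun hh i => h2 i (Or.inr hh), fun i hi => h2 i (Or.inl hi), h3, h4, h5, ?_⟩
    -- As t is injective, the entry 2k + h occurs once and contributes a single 2h.
    rwa [sum_minDistTerm, Finset.sum_filter (fun i => t i = 2 * k + h),
      Finset.sum_eq_single i₀ (fun i _ hi => if_neg fun heq =>
        hi (ht.injective (heq.trans hi₀.symm))) (fun hi => absurd (Finset.mem_univ _) hi),
      if_pos hi₀] at h6
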